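/- **Setting.** On $\mathbb R^{1+3}$ with the metric $x\cdot x=x_0^2-x_1^2-x_2^2-x_3^2$, let $\mathcal P_+^\uparrow=\mathbb R^{4}\rtimes\mathcal L_+^\uparrow$ be the proper orthochronous Poincaré group, where $\mathcal L_+^\uparrow$ is the identity component of the Lorentz group. A wedge is a region $W=gW_1$ with $g\in\mathcal P_+^\uparrow$ and $W_1=\{x:|x_0|<x_1\}$; $\mathcal W$ is the set of wedges. The causal complement $W'$ of a wedge $W$ is the interior of the set of points spacelike separated from every point of $W$; it is again a wedge. Let $\Lambda_{W_1}(t)$ be the boosts $(x_0,x_1)\mapsto(\cosh t\,x_0+\sinh t\,x_1,\ \sinh t\,x_0+\cosh t\,x_1)$, with $x_2,x_3$ fixed, and put $\Lambda_W(t)=g\Lambda_{W_1}(t)g^{-1}$ for $W=gW_1$ (this does not depend on the choice of $g$). Let $\mathcal H$ be a complex Hilbert space. For a closed real linear subspace $K\subset\mathcal H$ let $K'=\{x\in\mathcal H:\operatorname{Im}\langle y,x\rangle=0\ \ \forall y\in K\}$; $K$ is cyclic if $K+iK$ is dense, separating if $K\cap iK=\{0\}$, and standard if it is both. For a standard subspace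 $K$ let $S_K$ be the closure of the antilinear operator $\xi+i\eta\mapsto\xi-i\eta$ ($\xi,\eta\in K$), and let $\Delta_K=S_K^*S_K$, a positive self-adjoint injective operator, so that the unitaries $\Delta_K^{it}$, $t\in\mathbb R$, are defined by the functional calculus. Let $U$ be a strongly continuous unitary representation of $\mathcal P_+^\uparrow$ on $\mathcal H$ with positive energy (for every $a$ in the closed forward light cone, the self-adjoint generator $P_a$ in $U(sa)=e^{isP_a}$, $s\in\mathbb R$, is positive). Let $H$ be a map that assigns to every $W\in\mathcal W$ a closed real linear subspace $H(W)\subset\mathcal H$ such that 1. (isotony) $H(V_1)\subset H(V_2)$ whenever $V_1\subset V_2$ are wedges; 2. (covariance) $U(g)H(V)=H(gV)$ for all $V\in\mathcal W$ and $g\in\mathcal P_+^\uparrow$; 3. (Reeh–Schlieder) $H(V)$ is cyclic for every $V\in\mathcal W$; 4. (locality) $H(V_1)\subset H(V_2)'$ whenever $V_1,V_2$ are wedges with $V_1\subset V_2'$. Then every $H(V)$ is standard. **Theorem.** Let $(U,H)$ be as above, let $W\in\mathcal W$, and let $r_W\in\mathcal P_+^\uparrow$ satisfy $r_WW=W'$.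 Suppose that $$Z_{H(W)}(t)=\Delta_{H(W)}^{it}\,U(\Lambda_W(2\pi t))$$ commutes with $U(r_W)$ for every $t\in\mathbb R$. Then the Bisognano–Wichmann property $$U(\Lambda_V(2\pi t))=\Delta_{H(V)}^{-it}\qquad\text{for all }V\in\mathcal W,\ t\in\mathbb R,$$ and wedge duality $$H(V)=H(V')'\qquad\text{for all }V\in\mathcal W$$ both hold. -/

import Mathlib

noncomputable section ModularTheory

namespace StandardSubspace

open Complex ClosedSubmodule
open scoped ComplexOrder ComplexInnerProductSpace InnerProduct

variable {H : Type*} [NormedAddCommGroup H] [InnerProductSpace ℂ H]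

/-- The graph `{(ξ + iη, ξ - iη) | ξ, η ∈ K}`. -/
def tomitaGraph (K : StandardSubspace H) : Submodule ℝ (H × H) where
  carrier := {p | ∃ ξ ∈ K.toClosedSubmodule, ∃ η ∈ K.toClosedSubmodule,
    p = (ξ + I • η, ξ - I • η)}
  add_mem' := by
    rintro _ _ ⟨ξ, hξ, η, hη, rfl⟩ ⟨ξ', hξ', η', hη', rfl⟩
    refine ⟨ξ + ξ', add_mem hξ hξ', η + η', add_mem hη hη', ?_⟩
    ext <;> simp only [Prod.mk_add_mk, smul_add] <;> abel
  zero_mem' := ⟨0, zero_mem _, 0, zero_mem _, by simp [Prod.ext_iff]⟩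
  smul_mem' := by
    rintro c _ ⟨ξ, hξ, η, hη, rfl⟩
    refine ⟨c • ξ, SMulMemClass.smul_mem c hξ, c • η, SMulMemClass.smul_mem c hη, ?_⟩
    ext <;> simp [smul_add, smul_sub, smul_comm I c η]

theorem mem_tomitaGraph {K : StandardSubspace H} {p : H × H} :
    p ∈ K.tomitaGraph ↔
      p.1 + p.2 ∈ K.toClosedSubmodule ∧ I • (p.1 - p.2) ∈ K.toClosedSubmodule := by
  constructor
  · rintro ⟨ξ, hξ, η, hη, rfl⟩
    refine ⟨?_, ?_⟩
    · have : ξ + I • η + (ξ - I • η) = (2 : ℝ) • ξ := by rw [two_smul]; abel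
      rw [this]; exact SMulMemClass.smul_mem _ hξ
    · have : I • (ξ + I • η - (ξ - I • η)) = (-2 : ℝ) • η := by
        have : ξ + I • η - (ξ - I • η) = I • η + I • η := by abel
        rw [this, smul_add, smul_smul, I_mul_I, neg_smul, neg_smul, one_smul, two_smul]; abel
      rw [this]; exact SMulMemClass.smul_mem _ hη
  · rintro ⟨h1, h2⟩
    refine ⟨(1 / 2 : ℝ) • (p.1 + p.2), SMulMemClass.smul_mem _ h1,
      (-(1 / 2) : ℝ) • (I • (p.1 - p.2)), SMulMemClass.smul_mem _ h2, ?_⟩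
    have e : I • (-(1 / 2) : ℝ) • (I • (p.1 - p.2)) = (1 / 2 : ℝ) • (p.1 - p.2) := by
      rw [smul_comm I, smul_smul I I, I_mul_I, neg_one_smul, neg_smul, smul_neg, neg_neg]
    rw [e]
    ext
    · have : p.1 = (1 / 2 : ℝ) • (p.1 + p.1) := by rw [← two_smul ℝ p.1, smul_smul]; simp
      change p.1 = _
      rw [← smul_add]; convert this using 2; abel
    · have : p.2 = (1 / 2 : ℝ) • (p.2 + p.2) := by rw [← two_smul ℝ p.2, smul_smul]; simp
      change p.2 = _
      rw [← smul_sub]; convert this using 2; abel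

theorem tomitaGraph_isClosed (K : StandardSubspace H) :
    IsClosed (K.tomitaGraph : Set (H × H)) := by
  have hK : IsClosed (K.toClosedSubmodule : Set H) := K.toClosedSubmodule.isClosed'
  have : (K.tomitaGraph : Set (H × H)) =
      (fun p : H × H => p.1 + p.2) ⁻¹' (K.toClosedSubmodule : Set H) ∩
      (fun p : H × H => I • (p.1 - p.2)) ⁻¹' (K.toClosedSubmodule : Set H) := by
    ext p; exact mem_tomitaGraph
  rw [this]
  exact (hK.preimage (by fun_prop)).inter (hK.preimage (by fun_prop))

theorem tomitaGraph_snd_eq_zero (K : StandardSubspace H) :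
    ∀ p ∈ K.tomitaGraph, p.1 = 0 → p.2 = 0 := by
  intro p hp h0
  obtain ⟨h1, h2⟩ := mem_tomitaGraph.1 hp
  rw [h0, zero_add] at h1
  rw [h0, zero_sub, smul_neg] at h2
  have : p.2 ∈ K.toClosedSubmodule ⊓ K.toClosedSubmodule.mulI := by
    refine ⟨h1, ?_⟩
    change p.2 ∈ K.toClosedSubmodule.mulI
    rw [mem_mapEquiv_iff, scalarSMulCLE_symm_apply]
    simpa [Units.smul_def] using h2
  rw [K.IsSeparating] at this
  simpa using this

/-- The involution `ξ + iη ↦ ξ - iη` on `K + iK`, as a real linear operator. -/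
def tomitaCore (K : StandardSubspace H) : H →ₗ.[ℝ] H := K.tomitaGraph.toLinearPMap

/-- The Tomita operator `S_K`. It is antilinear; here it is recorded as a real linear operator. -/
def tomita (K : StandardSubspace H) : H →ₗ.[ℝ] H := K.tomitaCore.closure

theorem tomita_graph (K : StandardSubspace H) : K.tomita.graph = K.tomitaGraph := by
  have hg : K.tomitaCore.graph = K.tomitaGraph :=
    Submodule.toLinearPMap_graph_eq _ K.tomitaGraph_snd_eq_zero
  have hc : K.tomitaCore.IsClosed := by
    rw [LinearPMap.IsClosed, hg]; exact K.tomitaGraph_isClosed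
  rw [tomita, ← hc.isClosable.graph_closure_eq_closure_graph, hg]
  exact K.tomitaGraph_isClosed.submodule_topologicalClosure_eq

theorem tomita_smul {K : StandardSubspace H} {x y : H} (c : ℂ)
    (h : (x, y) ∈ K.tomita.graph) : (c • x, (starRingEnd ℂ) c • y) ∈ K.tomita.graph := by
  rw [tomita_graph, mem_tomitaGraph] at h ⊢
  obtain ⟨h1, h2⟩ := h
  dsimp only at h1 h2 ⊢
  have e1 : c • x + (starRingEnd ℂ) c • y = c.re • (x + y) + c.im • (I • (x - y)) := by
    conv_lhs => rw [← Complex.re_add_im c]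
    simp only [map_add, map_mul, conj_ofReal, conj_I, ← Complex.coe_smul]
    module
  have e2 : I • (c • x - (starRingEnd ℂ) c • y) = c.re • (I • (x - y)) + (-c.im) • (x + y) := by
    conv_lhs => rw [← Complex.re_add_im c]
    simp only [map_add, map_mul, conj_ofReal, conj_I, ← Complex.coe_smul, ofReal_neg]
    have hI : I ^ 2 = -1 := I_sq
    rw [smul_sub, smul_smul, smul_smul, mul_add, mul_add]
    have e3 : I * (c.im * I) = -(c.im : ℂ) := by linear_combination (c.im : ℂ) * hI
    have e4 : I * (c.im * -I) = (c.im : ℂ) := by linear_combination -(c.im : ℂ) * hI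
    rw [e3, e4]
    module
  rw [e1, e2]
  exact ⟨add_mem (SMulMemClass.smul_mem _ h1) (SMulMemClass.smul_mem _ h2),
    add_mem (SMulMemClass.smul_mem _ h2) (SMulMemClass.smul_mem _ h1)⟩

theorem tomita_domain_dense (K : StandardSubspace H) : Dense (K.tomita.domain : Set H) := by
  have hmem : ∀ x ∈ K.toClosedSubmodule.toSubmodule ⊔ K.toClosedSubmodule.mulI.toSubmodule,
      x ∈ K.tomita.domain := by
    intro x hx
    obtain ⟨ξ, hξ, η, hη, rfl⟩ := Submodule.mem_sup.1 hx
    have hη' : η ∈ K.toClosedSubmodule.mulI := hη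
    rw [mem_mapEquiv_iff, scalarSMulCLE_symm_apply] at hη'
    have : (ξ + η, ξ - η) ∈ K.tomita.graph := by
      rw [tomita_graph]
      refine ⟨ξ, hξ, _, hη', ?_⟩
      simp [Units.smul_def, smul_smul]
    exact LinearPMap.mem_domain_of_mem_graph this
  have h : (K.toClosedSubmodule ⊔ K.toClosedSubmodule.mulI : ClosedSubmodule ℝ H) = ⊤ := K.IsCyclic
  intro x
  have hx : x ∈ (K.toClosedSubmodule ⊔ K.toClosedSubmodule.mulI : ClosedSubmodule ℝ H) := by
    rw [h]; trivial
  exact closure_mono hmem hx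

variable [CompleteSpace H]

theorem mem_tomita_adjoint_graph {K : StandardSubspace H} {y z : H} :
    (y, z) ∈ K.tomita.adjoint.graph ↔
      ∀ a b, (a, b) ∈ K.tomita.graph → inner ℝ b y = inner ℝ a z := by
  rw [LinearPMap.adjoint_graph_eq_graph_adjoint K.tomita_domain_dense, Submodule.mem_adjoint_iff]
  simp only [sub_eq_zero]

theorem tomita_adjoint_smul {K : StandardSubspace H} {y z : H} (c : ℂ)
    (h : (y, z) ∈ K.tomita.adjoint.graph) :
    ((starRingEnd ℂ) c • y, c • z) ∈ K.tomita.adjoint.graph := by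
  rw [mem_tomita_adjoint_graph] at h ⊢
  intro a b hab
  have := h _ _ (tomita_smul ((starRingEnd ℂ) c) hab)
  simpa [inner_real_eq_re_inner, inner_smul_left, inner_smul_right, mul_comm] using this

/-- The graph of `S_K^* S_K`. -/
def modularGraph (K : StandardSubspace H) : Submodule ℂ (H × H) where
  carrier := {p | ∃ y, (p.1, y) ∈ K.tomita.graph ∧ (y, p.2) ∈ K.tomita.adjoint.graph}
  add_mem' := by
    rintro _ _ ⟨y, h1, h2⟩ ⟨y', h1', h2'⟩
    exact ⟨y + y', add_mem h1 h1', add_mem h2 h2'⟩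
  zero_mem' := ⟨0, zero_mem _, zero_mem _⟩
  smul_mem' := by
    rintro c _ ⟨y, h1, h2⟩
    exact ⟨(starRingEnd ℂ) c • y, tomita_smul c h1, tomita_adjoint_smul c h2⟩

/-- The modular operator `Δ_K = S_K^* S_K`, an unbounded complex linear operator. -/
def modularOperator (K : StandardSubspace H) : H →ₗ.[ℂ] H := K.modularGraph.toLinearPMap

theorem modularOperator_graph (K : StandardSubspace H) :
    K.modularOperator.graph = K.modularGraph := by
  refine Submodule.toLinearPMap_graph_eq _ ?_
  rintro ⟨x, z⟩ ⟨y, h1, h2⟩ (rfl : x = 0)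
  have hy : y = 0 := LinearPMap.graph_fst_eq_zero_snd _ h1 rfl
  exact LinearPMap.graph_fst_eq_zero_snd _ h2 hy

theorem exists_tomita_of_modular {K : StandardSubspace H} {x z : H}
    (h : (x, z) ∈ K.modularOperator.graph) :
    ∃ y, (x, y) ∈ K.tomita.graph ∧ ∀ x' y', (x', y') ∈ K.tomita.graph →
      inner ℝ y' y = inner ℝ x' z := by
  rw [modularOperator_graph] at h
  obtain ⟨y, h1, h2⟩ := h
  exact ⟨y, h1, fun x' y' h' => mem_tomita_adjoint_graph.1 h2 _ _ h'⟩

theorem modular_re_inner_nonneg {K : StandardSubspace H} {x z : H}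
    (h : (x, z) ∈ K.modularOperator.graph) : 0 ≤ inner ℝ x z := by
  obtain ⟨y, h1, h2⟩ := exists_tomita_of_modular h
  rw [← h2 _ _ h1]
  exact real_inner_self_nonneg

theorem modular_symm {K : StandardSubspace H} {x z x' z' : H}
    (h : (x, z) ∈ K.modularOperator.graph) (h' : (x', z') ∈ K.modularOperator.graph) :
    inner ℝ x z' = inner ℝ z x' := by
  obtain ⟨y, h1, h2⟩ := exists_tomita_of_modular h
  obtain ⟨y', h1', h2'⟩ := exists_tomita_of_modular h'
  rw [← h2' _ _ h1, real_inner_comm x' z, ← h2 _ _ h1', real_inner_comm]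

theorem modular_injective {K : StandardSubspace H} {x : H}
    (h : (x, 0) ∈ K.modularOperator.graph) : x = 0 := by
  obtain ⟨y, h1, h2⟩ := exists_tomita_of_modular h
  have hy : y = 0 := by simpa using h2 _ _ h1
  subst hy
  rw [tomita_graph, mem_tomitaGraph] at h1
  have : (0, x) ∈ K.tomitaGraph := by
    rw [mem_tomitaGraph]
    refine ⟨by simpa using h1.1, ?_⟩
    have h5 : I • x ∈ K.toClosedSubmodule := by simpa using h1.2
    have h6 : (-1 : ℝ) • I • x ∈ K.toClosedSubmodule := SMulMemClass.smul_mem _ h5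
    simpa using h6
  exact K.tomitaGraph_snd_eq_zero _ this rfl

theorem exists_resolvent_apply (K : StandardSubspace H) (x : H) :
    ∃! y, (y, x - y) ∈ K.modularOperator.graph := by
  refine existsUnique_of_exists_of_unique ?_ ?_
  · let G : Submodule ℝ (WithLp 2 (H × H)) :=
      K.tomitaGraph.comap (WithLp.linearEquiv 2 ℝ (H × H)).toLinearMap
    have hG : IsClosed (G : Set (WithLp 2 (H × H))) :=
      K.tomitaGraph_isClosed.preimage (WithLp.prod_continuous_ofLp 2 H H)
    have : CompleteSpace G := hG.completeSpace_coe
    obtain ⟨p, hp, q, hq, hpq⟩ := G.exists_add_mem_mem_orthogonal (WithLp.toLp 2 (x, 0))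
    have hpG : (p.fst, p.snd) ∈ K.tomitaGraph := hp
    have e1 : q.fst = x - p.fst := by
      have := congrArg WithLp.fst hpq; simp at this; rw [this]; abel
    have e2 : q.snd = - p.snd := by
      have := congrArg WithLp.snd hpq; simp at this
      exact (neg_eq_of_add_eq_zero_right this.symm).symm
    refine ⟨p.fst, ?_⟩
    rw [modularOperator_graph]
    refine ⟨p.snd, by rw [tomita_graph]; exact hpG, ?_⟩
    rw [mem_tomita_adjoint_graph]
    intro a b hab
    rw [tomita_graph] at hab
    have := (Submodule.mem_orthogonal _ _).1 hq (WithLp.toLp 2 (a, b)) hab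
    rw [WithLp.prod_inner_apply] at this
    simp only [WithLp.ofLp_fst, WithLp.ofLp_snd, e1, e2] at this
    simp only [inner_neg_right] at this
    change inner ℝ b p.snd = inner ℝ a (x - p.fst)
    linarith
  · intro y y' h h'
    have h0 : (y - y', -(y - y')) ∈ K.modularOperator.graph := by
      have := sub_mem h h'
      simpa using this
    have := modular_re_inner_nonneg h0
    rw [inner_neg_right, real_inner_self_eq_norm_sq] at this
    have h2 : ‖y - y'‖ = 0 := by nlinarith [norm_nonneg (y - y')]
    exact sub_eq_zero.1 (norm_eq_zero.1 h2)

theorem exists_resolvent (K : StandardSubspace H) :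
    ∃ B : H →L[ℂ] H, ∀ x y, B x = y ↔ (y, x - y) ∈ K.modularOperator.graph := by
  choose R hR hu using K.exists_resolvent_apply
  refine ⟨LinearMap.mkContinuous
    { toFun := R
      map_add' := fun x x' => ?_
      map_smul' := fun c x => ?_ } 1 ?_, fun x y => ⟨?_, fun h => (hu x y h).symm⟩⟩
  · refine (hu _ _ ?_).symm
    have := add_mem (hR x) (hR x')
    simp only [Prod.mk_add_mk] at this
    convert this using 2; abel
  · refine (hu _ _ ?_).symm
    have := Submodule.smul_mem _ c (hR x)
    simpa [smul_sub] using this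
  · intro x
    have := modular_re_inner_nonneg (hR x)
    rw [inner_sub_right, real_inner_self_eq_norm_sq] at this
    have h2 := real_inner_le_norm (R x) x
    change ‖R x‖ ≤ 1 * ‖x‖
    by_contra! hlt
    nlinarith [norm_nonneg (R x), norm_nonneg x]
  · rintro rfl; exact hR x

/-- The bounded operator `(1 + Δ_K)⁻¹`. -/
def modularResolvent (K : StandardSubspace H) : H →L[ℂ] H := K.exists_resolvent.choose

theorem modularResolvent_eq_iff (K : StandardSubspace H) (x y : H) :
    K.modularResolvent x = y ↔ (y, x - y) ∈ K.modularOperator.graph :=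
  K.exists_resolvent.choose_spec x y

/-- `f(Δ_K)` for `f` continuous with compact support in `(0, ∞)`: if `B = (1 + Δ_K)⁻¹` then
`Δ_K = B⁻¹ - 1`, so `f(Δ_K)` is the function `b ↦ f (b⁻¹ - 1)` of the bounded self-adjoint
operator `B`. -/
def modularFunction (K : StandardSubspace H) (f : ℝ → ℂ) : H →L[ℂ] H :=
  cfc (fun z : ℂ => f (z.re⁻¹ - 1)) K.modularResolvent

theorem modularResolvent_mem (K : StandardSubspace H) (x : H) :
    (K.modularResolvent x, x - K.modularResolvent x) ∈ K.modularOperator.graph :=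
  (K.modularResolvent_eq_iff x _).1 rfl

theorem modularResolvent_isPositive (K : StandardSubspace H) :
    K.modularResolvent.IsPositive := by
  have hre : ∀ x x' : H, (⟪K.modularResolvent x, x'⟫).re = (⟪x, K.modularResolvent x'⟫).re := by
    intro x x'
    have := modular_symm (K.modularResolvent_mem x) (K.modularResolvent_mem x')
    simp only [inner_real_eq_re_inner, inner_sub_left, inner_sub_right] at this
    linarith
  rw [ContinuousLinearMap.isPositive_def']
  refine ⟨?_, fun x => ?_⟩
  · rw [ContinuousLinearMap.isSelfAdjoint_iff_isSymmetric]
    intro x x'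
    apply Complex.ext
    · exact hre x x'
    · have := hre x (I • x')
      simpa [inner_smul_right] using this
  · have := modular_re_inner_nonneg (K.modularResolvent_mem x)
    rw [inner_sub_right, real_inner_self_eq_norm_sq, inner_real_eq_re_inner] at this
    change 0 ≤ (⟪K.modularResolvent x, x⟫).re
    nlinarith [norm_nonneg (K.modularResolvent x)]

theorem modularResolvent_compl_isPositive (K : StandardSubspace H) :
    (1 - K.modularResolvent).IsPositive := by
  rw [ContinuousLinearMap.isPositive_def']
  refine ⟨(IsSelfAdjoint.one _).sub K.modularResolvent_isPositive.isSelfAdjoint, fun x => ?_⟩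
  have := modular_re_inner_nonneg (K.modularResolvent_mem x)
  have h2 : 0 ≤ inner ℝ (x - K.modularResolvent x) (x - K.modularResolvent x) :=
    real_inner_self_nonneg
  rw [inner_sub_left (x := x) (y := K.modularResolvent x)] at h2
  change 0 ≤ (⟪x - K.modularResolvent x, x⟫).re
  have h3 : inner ℝ (x - K.modularResolvent x) x
      = inner ℝ x (x - K.modularResolvent x) := real_inner_comm _ _
  rw [← inner_real_eq_re_inner, h3]
  linarith

theorem modularResolvent_spectrum (K : StandardSubspace H) {z : ℂ}
    (hz : z ∈ spectrum ℂ K.modularResolvent) : z = z.re ∧ z.re ∈ Set.Icc (0 : ℝ) 1 := by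
  have h0 : (0 : H →L[ℂ] H) ≤ K.modularResolvent :=
    (ContinuousLinearMap.nonneg_iff_isPositive _).2 K.modularResolvent_isPositive
  have h1 : (0 : H →L[ℂ] H) ≤ 1 - K.modularResolvent :=
    (ContinuousLinearMap.nonneg_iff_isPositive _).2 K.modularResolvent_compl_isPositive
  refine ⟨K.modularResolvent_isPositive.isSelfAdjoint.mem_spectrum_eq_re hz, ?_, ?_⟩
  · exact (Complex.le_def.1 (spectrum_nonneg_of_nonneg h0 hz)).1
  · have : 1 - z ∈ spectrum ℂ (1 - K.modularResolvent) := by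
      rw [spectrum.mem_iff] at hz ⊢
      intro hu
      apply hz
      convert hu.neg using 1
      simp only [map_sub, map_one]; abel
    have := (Complex.le_def.1 (spectrum_nonneg_of_nonneg h1 this)).1
    simpa using this

/-- Continuous functions on `(0, ∞)` vanishing at `0` and at `∞`, extended by `0` to `ℝ`. -/
structure VanishesAtEnds (f : ℝ → ℂ) : Prop where
  continuous : Continuous f
  eq_zero : ∀ x ≤ 0, f x = 0
  tendsto : Filter.Tendsto f Filter.atTop (nhds 0)

theorem VanishesAtEnds.continuousOn {f : ℝ → ℂ} (hf : VanishesAtEnds f) :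
    ContinuousOn (fun z : ℂ => f (z.re⁻¹ - 1)) {z | 0 ≤ z.re} := by
  have key : ContinuousOn (fun b : ℝ => f (b⁻¹ - 1)) (Set.Ici 0) := by
    intro b hb
    rcases eq_or_lt_of_le (show (0 : ℝ) ≤ b from hb) with rfl | hb
    · rw [← Set.Ioi_insert, continuousWithinAt_insert_self]
      have h0 : f ((0 : ℝ)⁻¹ - 1) = 0 := hf.eq_zero _ (by norm_num)
      rw [ContinuousWithinAt, h0]
      refine hf.tendsto.comp ?_
      exact Filter.tendsto_atTop_add_const_right _ (-1) tendsto_inv_nhdsGT_zero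
    · have : ContinuousAt (fun b : ℝ => b⁻¹ - 1) b := by
        have := hb.ne'
        fun_prop (disch := assumption)
      exact (hf.continuous.continuousAt.comp this).continuousWithinAt
  exact key.comp Complex.continuous_re.continuousOn fun z hz => hz

theorem norm_cpow_I_mul {x : ℝ} (hx : 0 < x) (t : ℝ) : ‖(x : ℂ) ^ (I * t)‖ = 1 := by
  rw [Complex.norm_cpow_eq_rpow_re_of_pos hx]; simp

theorem VanishesAtEnds.cpow_mul {f : ℝ → ℂ} (hf : VanishesAtEnds f) (t : ℝ) :
    VanishesAtEnds fun x : ℝ => (x : ℂ) ^ (I * t) * f x := by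
  have hle : ∀ x : ℝ, ‖(x : ℂ) ^ (I * t) * f x‖ ≤ ‖f x‖ := by
    intro x
    rcases le_or_gt x 0 with hx | hx
    · simp [hf.eq_zero x hx]
    · rw [norm_mul, norm_cpow_I_mul hx, one_mul]
  refine ⟨continuous_iff_continuousAt.2 fun x => ?_, fun x hx => by simp [hf.eq_zero x hx], ?_⟩
  · rcases le_or_gt x 0 with hx | hx
    · have hz := hf.eq_zero x hx
      rw [ContinuousAt, hz, mul_zero]
      refine squeeze_zero_norm hle ?_
      have := hf.continuous.norm.tendsto x
      rwa [hz, norm_zero] at this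
    · refine ContinuousAt.mul ?_ hf.continuous.continuousAt
      exact (Complex.continuous_ofReal.continuousAt).cpow continuousAt_const (Or.inl hx)
  · exact squeeze_zero_norm hle (by simpa using hf.tendsto.norm)

theorem modularFunction_mul (K : StandardSubspace H) {f g : ℝ → ℂ} (hf : VanishesAtEnds f)
    (hg : VanishesAtEnds g) :
    K.modularFunction (fun x => f x * g x) = K.modularFunction f * K.modularFunction g :=
  cfc_mul _ _ _ (hf.continuousOn.mono fun _ hz => (K.modularResolvent_spectrum hz).2.1)
    (hg.continuousOn.mono fun _ hz => (K.modularResolvent_spectrum hz).2.1)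

/-- The function `x / (1 + x)²` on `(0, ∞)`, whose value at `Δ_K` is `B (1 - B)`. -/
def bump (x : ℝ) : ℂ := if x ≤ 0 then 0 else ((x / (1 + x) ^ 2 : ℝ) : ℂ)

theorem bump_vanishesAtEnds : VanishesAtEnds bump := by
  refine ⟨?_, fun x hx => if_pos hx, ?_⟩
  · have : bump = fun x : ℝ => ((max x 0 / (1 + max x 0) ^ 2 : ℝ) : ℂ) := by
      funext x
      unfold bump
      split_ifs with h
      · simp [max_eq_right h]
      · simp [max_eq_left (not_le.1 h).le]
    rw [this]
    refine Complex.continuous_ofReal.comp (Continuous.div (by fun_prop) (by fun_prop) fun x => ?_)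
    positivity
  · refine squeeze_zero_norm' (a := fun x : ℝ => x⁻¹) ?_ tendsto_inv_atTop_zero
    filter_upwards [Filter.eventually_gt_atTop 0] with x hx
    rw [bump, if_neg (not_le.2 hx), Complex.norm_real, Real.norm_of_nonneg (by positivity),
      inv_eq_one_div, div_le_div_iff₀ (by positivity) hx]
    nlinarith

theorem modularFunction_bump (K : StandardSubspace H) :
    K.modularFunction bump = K.modularResolvent * (1 - K.modularResolvent) := by
  have hn : IsStarNormal K.modularResolvent :=
    K.modularResolvent_isPositive.isSelfAdjoint.isStarNormal
  have h1 : K.modularFunction bump = cfc (fun z : ℂ => z * (1 - z)) K.modularResolvent := by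
    refine cfc_congr fun z hz => ?_
    obtain ⟨hz, h0, h1⟩ := K.modularResolvent_spectrum hz
    obtain ⟨b, rfl⟩ : ∃ b : ℝ, z = b := ⟨_, hz⟩
    simp only [Complex.ofReal_re] at h0 h1 ⊢
    clear hz
    rcases eq_or_lt_of_le h0 with rfl | h0
    · simp [bump]
    rcases eq_or_lt_of_le h1 with rfl | h1
    · simp [bump]
    have : ¬ b⁻¹ - 1 ≤ 0 := by
      have := (one_lt_inv₀ h0).2 h1
      linarith
    rw [bump, if_neg this]
    have : (b⁻¹ - 1) / (1 + (b⁻¹ - 1)) ^ 2 = b * (1 - b) := by field_simp; ring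
    rw [this]; push_cast; ring
  rw [h1, cfc_mul _ _ _ (by fun_prop) (by fun_prop), cfc_sub _ _ _ (by fun_prop) (by fun_prop),
    cfc_id' ℂ K.modularResolvent, cfc_const_one ℂ K.modularResolvent]

theorem modularFunction_bump_denseRange (K : StandardSubspace H) :
    DenseRange (K.modularFunction bump) := by
  have hsa : IsSelfAdjoint (K.modularFunction bump) := by
    rw [modularFunction_bump]
    have h := K.modularResolvent_isPositive.isSelfAdjoint
    exact (h.commute_iff ((IsSelfAdjoint.one _).sub h)).1
      ((Commute.one_right _).sub_right (Commute.refl _))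
  have hinj : ∀ x, K.modularFunction bump x = 0 → x = 0 := by
    intro x hx
    rw [modularFunction_bump] at hx
    have h1 : x - K.modularResolvent x = 0 := by
      have := (K.modularResolvent_eq_iff (x - K.modularResolvent x) 0).1 hx
      rw [sub_zero] at this
      exact LinearPMap.graph_fst_eq_zero_snd _ this rfl
    have h2 := K.modularResolvent_mem x
    rw [h1] at h2
    rw [sub_eq_zero.1 h1]
    exact modular_injective h2
  have hd := Submodule.dense_iff_topologicalClosure_eq_top
    (s := LinearMap.range (K.modularFunction bump).toLinearMap)
  refine (hd.2 ?_ : Dense _)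
  rw [Submodule.topologicalClosure_eq_top_iff, Submodule.eq_bot_iff]
  intro x hx
  apply hinj
  rw [Submodule.mem_orthogonal] at hx
  refine ext_inner_left ℂ fun y => ?_
  rw [inner_zero_right, ← hx _ ⟨y, rfl⟩]
  exact (hsa.isSymmetric y x).symm

/-- `V = Δ_K^{it}`: for every continuous `f` on `(0, ∞)` vanishing at both ends,
`V f(Δ_K) = g(Δ_K)` with `g(x) = x^{it} f(x)`. -/
def IsModularPower (K : StandardSubspace H) (t : ℝ) (V : H →L[ℂ] H) : Prop :=
  ∀ f : ℝ → ℂ, VanishesAtEnds f →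
    V * K.modularFunction f = K.modularFunction fun x => (x : ℂ) ^ (I * t) * f x

theorem existsUnique_modularPower (K : StandardSubspace H) (t : ℝ) :
    ∃! V : H →L[ℂ] H, K.IsModularPower t V := by
  have hd := K.modularFunction_bump_denseRange
  refine existsUnique_of_exists_of_unique ?_ ?_
  · set C := K.modularFunction bump with hC
    set D := K.modularFunction fun x => (x : ℂ) ^ (I * t) * bump x with hD
    have hstar : star D * D = star C * C := by
      have h1 := (bump_vanishesAtEnds.cpow_mul t).continuousOn.mono
        (fun _ hz => (K.modularResolvent_spectrum hz).2.1 :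
          spectrum ℂ K.modularResolvent ⊆ {z | 0 ≤ z.re})
      have h2 := bump_vanishesAtEnds.continuousOn.mono
        (fun _ hz => (K.modularResolvent_spectrum hz).2.1 :
          spectrum ℂ K.modularResolvent ⊆ {z | 0 ≤ z.re})
      simp only [hC, hD, modularFunction]
      rw [← cfc_star, ← cfc_star, ← cfc_mul _ _ _ h1.star h1, ← cfc_mul _ _ _ h2.star h2]
      refine cfc_congr fun z _ => ?_
      generalize z.re⁻¹ - 1 = x
      rcases le_or_gt x 0 with hx | hx
      · simp [bump, hx]
      · have := norm_cpow_I_mul hx t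
        simp only [star_mul, RCLike.star_def]
        have h3 : (starRingEnd ℂ) ((x : ℂ) ^ (I * t)) * (x : ℂ) ^ (I * t) = 1 := by
          rw [← Complex.normSq_eq_conj_mul_self, Complex.normSq_eq_norm_sq, this]; simp
        linear_combination (starRingEnd ℂ) (bump x) * bump x * h3
    have hnorm : ∀ x, ‖D x‖ = ‖C x‖ := by
      intro x
      have h : ∀ T : H →L[ℂ] H, (‖T x‖ : ℂ) ^ 2 = ⟪x, (star T * T) x⟫ := by
        intro T
        rw [ContinuousLinearMap.star_eq_adjoint]
        change _ = ⟪x, T.adjoint (T x)⟫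
        rw [ContinuousLinearMap.adjoint_inner_right, inner_self_eq_norm_sq_to_K]; rfl
      have h3 : (‖D x‖ : ℂ) ^ 2 = (‖C x‖ : ℂ) ^ 2 := by rw [h, h, hstar]
      norm_cast at h3
      exact (sq_eq_sq₀ (norm_nonneg _) (norm_nonneg _)).1 h3
    let V : H →L[ℂ] H := D.toLinearMap.extendOfNorm C.toLinearMap
    have hV : V * C = D := by
      ext x
      exact LinearMap.extendOfNorm_eq (f := D.toLinearMap) (e := C.toLinearMap) hd
        ⟨1, fun x => by rw [one_mul]; exact (hnorm x).le⟩ x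
    refine ⟨V, fun f hf => ?_⟩
    have hmul : V * K.modularFunction f * C =
        (K.modularFunction fun x => (x : ℂ) ^ (I * t) * f x) * C := by
      rw [mul_assoc, hC, ← modularFunction_mul K hf bump_vanishesAtEnds,
        ← modularFunction_mul K (hf.cpow_mul t) bump_vanishesAtEnds]
      have e1 : (fun x => f x * bump x) = fun x => bump x * f x := by funext x; ring
      rw [e1, modularFunction_mul K bump_vanishesAtEnds hf, ← mul_assoc, ← hC, hV, hD,
        ← modularFunction_mul K (bump_vanishesAtEnds.cpow_mul t) hf]
      congr 1; funext x; ring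
    ext x
    exact congrFun (hd.equalizer (V * K.modularFunction f).continuous
      (K.modularFunction fun x => (x : ℂ) ^ (I * t) * f x).continuous
      (funext fun y => congrArg (fun T : H →L[ℂ] H => T y) hmul)) x
  · intro V V' h h'
    have hmul := (h bump bump_vanishesAtEnds).trans (h' bump bump_vanishesAtEnds).symm
    ext x
    exact congrFun (hd.equalizer V.continuous V'.continuous
      (funext fun y => congrArg (fun T : H →L[ℂ] H => T y) hmul)) x

/-- The modular group `Δ_K^{it}`. -/
def modularGroup (K : StandardSubspace H) (t : ℝ) : H →L[ℂ] H :=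
  (K.existsUnique_modularPower t).choose

theorem modularGroup_spec (K : StandardSubspace H) (t : ℝ) :
    K.IsModularPower t (K.modularGroup t) :=
  (K.existsUnique_modularPower t).choose_spec.1

end StandardSubspace

end ModularTheory

noncomputable section Minkowski

open Matrix
open scoped Pointwise

/-- Minkowski spacetime `ℝ^{1+3}`, with the time coordinate `x 0`. -/
abbrev Spacetime : Type := Fin 4 → ℝ

/-- The Minkowski metric `diag(1, -1, -1, -1)`. -/
def minkowskiMetric : Matrix (Fin 4) (Fin 4) ℝ := Matrix.diagonal ![1, -1, -1, -1]

/-- The Minkowski square `x · x = x₀² - x₁² - x₂² - x₃²`. -/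
def minkowskiSq (x : Spacetime) : ℝ := x ⬝ᵥ minkowskiMetric *ᵥ x

/-- The full Lorentz group. -/
def lorentzGroup : Subgroup (GL (Fin 4) ℝ) where
  carrier := {Λ | (Λ : Matrix (Fin 4) (Fin 4) ℝ)ᵀ * minkowskiMetric * Λ = minkowskiMetric}
  mul_mem' := by
    intro A B hA hB
    simp only [Set.mem_ofPred_eq, Units.val_mul, transpose_mul] at *
    calc _ = (B : Matrix (Fin 4) (Fin 4) ℝ)ᵀ * ((A : Matrix (Fin 4) (Fin 4) ℝ)ᵀ *
          minkowskiMetric * A) * B := by simp only [Matrix.mul_assoc]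
      _ = _ := by rw [hA, hB]
  one_mem' := by simp
  inv_mem' := by
    intro A hA
    simp only [Set.mem_ofPred_eq] at *
    have h1 : (A : Matrix (Fin 4) (Fin 4) ℝ) * ((A⁻¹ : GL (Fin 4) ℝ) : Matrix (Fin 4) (Fin 4) ℝ)
        = 1 := by rw [← Units.val_mul]; simp
    have h2 : ((A⁻¹ : GL (Fin 4) ℝ) : Matrix (Fin 4) (Fin 4) ℝ)ᵀ *
        (A : Matrix (Fin 4) (Fin 4) ℝ)ᵀ = 1 := by
      rw [← transpose_mul, h1, transpose_one]
    conv_lhs => rw [← hA]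
    calc _ = (((A⁻¹ : GL (Fin 4) ℝ) : Matrix (Fin 4) (Fin 4) ℝ)ᵀ *
          (A : Matrix (Fin 4) (Fin 4) ℝ)ᵀ) * minkowskiMetric * ((A : Matrix (Fin 4) (Fin 4) ℝ) *
          ((A⁻¹ : GL (Fin 4) ℝ) : Matrix (Fin 4) (Fin 4) ℝ)) := by simp only [Matrix.mul_assoc]
      _ = _ := by rw [h1, h2]; simp

/-- The proper orthochronous Lorentz group, the connected component of the identity in the
Lorentz group. -/
def properLorentz : Subgroup lorentzGroup := Subgroup.connectedComponentOfOne lorentzGroup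

/-- The matrix of an element of the proper orthochronous Lorentz group. -/
def lorentzMatrix (Λ : properLorentz) : Matrix (Fin 4) (Fin 4) ℝ :=
  ((Λ : lorentzGroup) : GL (Fin 4) ℝ)

theorem lorentzMatrix_one : lorentzMatrix 1 = 1 := rfl

theorem lorentzMatrix_mul (Λ M : properLorentz) :
    lorentzMatrix (Λ * M) = lorentzMatrix Λ * lorentzMatrix M := rfl

theorem lorentzMatrix_isometry (Λ : properLorentz) (x : Spacetime) :
    minkowskiSq (lorentzMatrix Λ *ᵥ x) = minkowskiSq x := by
  have h : (lorentzMatrix Λ)ᵀ * minkowskiMetric * lorentzMatrix Λ = minkowskiMetric :=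
    (Λ : lorentzGroup).2
  unfold minkowskiSq
  conv_rhs => rw [← h]
  rw [← Matrix.mulVec_mulVec, ← Matrix.mulVec_mulVec, Matrix.dotProduct_mulVec _ (lorentzMatrix Λ)ᵀ,
    Matrix.vecMul_transpose]

/-- The action of Lorentz transformations on the additive group of translations. -/
def lorentzAut : properLorentz →* MulAut (Multiplicative Spacetime) where
  toFun Λ :=
    { toFun := fun a => Multiplicative.ofAdd (lorentzMatrix Λ *ᵥ a.toAdd)
      invFun := fun a => Multiplicative.ofAdd (lorentzMatrix Λ⁻¹ *ᵥ a.toAdd)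
      left_inv := fun a => by
        simp [Matrix.mulVec_mulVec, ← lorentzMatrix_mul, lorentzMatrix_one]
      right_inv := fun a => by
        simp [Matrix.mulVec_mulVec, ← lorentzMatrix_mul, lorentzMatrix_one]
      map_mul' := fun a b => by simp [Matrix.mulVec_add] }
  map_one' := by ext a; simp [lorentzMatrix_one]
  map_mul' Λ M := by ext a; simp [lorentzMatrix_mul, Matrix.mulVec_mulVec]

/-- The proper orthochronous Poincaré group: the semidirect product of the translations and the
proper orthochronous Lorentz group. -/
abbrev Poincare : Type := Multiplicative Spacetime ⋊[lorentzAut] properLorentz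

/-- The Poincaré transformation `x ↦ Λ x + a`. -/
def poincare (a : Spacetime) (Λ : properLorentz) : Poincare := ⟨Multiplicative.ofAdd a, Λ⟩

/-- The translation `x ↦ x + a`. -/
def translation (a : Spacetime) : Poincare := poincare a 1

/-- The pure Lorentz transformation `x ↦ Λ x`. -/
def lorentz (Λ : properLorentz) : Poincare := poincare 0 Λ

/-- The action `x ↦ Λ x + a` of the Poincaré group on spacetime. -/
instance : MulAction Poincare Spacetime where
  smul g x := lorentzMatrix g.right *ᵥ x + g.left.toAdd
  one_smul x := by
    change lorentzMatrix 1 *ᵥ x + 0 = x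
    simp [lorentzMatrix_one]
  mul_smul g h x := by
    change lorentzMatrix (g.right * h.right) *ᵥ x
        + (g.left.toAdd + lorentzMatrix g.right *ᵥ h.left.toAdd)
      = lorentzMatrix g.right *ᵥ (lorentzMatrix h.right *ᵥ x + h.left.toAdd) + g.left.toAdd
    rw [lorentzMatrix_mul, Matrix.mulVec_add, Matrix.mulVec_mulVec]
    abel

theorem poincare_smul_def (g : Poincare) (x : Spacetime) :
    g • x = lorentzMatrix g.right *ᵥ x + g.left.toAdd := rfl

theorem poincare_smul_sub (g : Poincare) (x y : Spacetime) :
    minkowskiSq (g • x - g • y) = minkowskiSq (x - y) := by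
  rw [poincare_smul_def, poincare_smul_def, add_sub_add_right_eq_sub, ← Matrix.mulVec_sub,
    lorentzMatrix_isometry]

instance : ContinuousConstSMul Poincare Spacetime where
  continuous_const_smul g := by
    have : (fun x : Spacetime => g • x) =
      fun x => lorentzMatrix g.right *ᵥ x + g.left.toAdd := rfl
    rw [this]
    fun_prop

/-- A path of Lorentz transformations starting at the identity stays in the identity component. -/
theorem mem_properLorentz_of_path (γ : ℝ → lorentzGroup) (hγ : Continuous γ) (h0 : γ 0 = 1)
    (t : ℝ) : γ t ∈ properLorentz :=
  (isPreconnected_range hγ).subset_connectedComponent ⟨0, h0⟩ ⟨t, rfl⟩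

/-- Builds a Lorentz transformation from its matrix and the matrix of its inverse. -/
def mkLorentz (A B : Matrix (Fin 4) (Fin 4) ℝ) (h1 : A * B = 1) (h2 : B * A = 1)
    (h : Aᵀ * minkowskiMetric * A = minkowskiMetric) : lorentzGroup :=
  ⟨⟨A, B, h1, h2⟩, h⟩

/-- The matrix of the boost with rapidity `t` in the `x₁` direction. -/
def boostMatrix (t : ℝ) : Matrix (Fin 4) (Fin 4) ℝ :=
  !![Real.cosh t, Real.sinh t, 0, 0; Real.sinh t, Real.cosh t, 0, 0; 0, 0, 1, 0; 0, 0, 0, 1]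

theorem boostMatrix_mul_neg (t : ℝ) : boostMatrix t * boostMatrix (-t) = 1 := by
  have := Real.cosh_sq t
  ext i j
  fin_cases i <;> fin_cases j <;>
    simp [boostMatrix, Matrix.mul_apply, Fin.sum_univ_four] <;> nlinarith

theorem boostMatrix_isometry (t : ℝ) :
    (boostMatrix t)ᵀ * minkowskiMetric * boostMatrix t = minkowskiMetric := by
  have := Real.cosh_sq t
  ext i j
  fin_cases i <;> fin_cases j <;>
    simp [boostMatrix, minkowskiMetric, Matrix.mul_apply, Fin.sum_univ_four,
      Matrix.diagonal_apply] <;> nlinarith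

/-- The boost `(x₀, x₁) ↦ (cosh t x₀ + sinh t x₁, sinh t x₀ + cosh t x₁)` in the Lorentz group. -/
def boostFull (t : ℝ) : lorentzGroup :=
  mkLorentz (boostMatrix t) (boostMatrix (-t)) (boostMatrix_mul_neg t)
    (by simpa using boostMatrix_mul_neg (-t)) (boostMatrix_isometry t)

theorem continuous_boostMatrix : Continuous boostMatrix := by
  refine continuous_matrix fun i j => ?_
  fin_cases i <;> fin_cases j <;> simp [boostMatrix] <;> fun_prop

theorem continuous_boostFull : Continuous boostFull := by
  refine Continuous.subtype_mk (f := fun t => (boostFull t : GL (Fin 4) ℝ))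
    (Units.continuous_iff.2 ⟨continuous_boostMatrix, ?_⟩) _
  exact continuous_boostMatrix.comp continuous_neg

theorem boostMatrix_zero : boostMatrix 0 = 1 := by
  ext i j; fin_cases i <;> fin_cases j <;> simp [boostMatrix]

theorem boostFull_zero : boostFull 0 = 1 :=
  Subtype.ext (Units.ext boostMatrix_zero)

/-- The boosts in the `x₁` direction in the proper orthochronous Lorentz group. -/
def boost (t : ℝ) : properLorentz :=
  ⟨boostFull t, mem_properLorentz_of_path _ continuous_boostFull boostFull_zero t⟩

/-- The matrix of the rotation by the angle `t` in the `(x₁, x₂)` plane. -/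
def rotationMatrix (t : ℝ) : Matrix (Fin 4) (Fin 4) ℝ :=
  !![1, 0, 0, 0; 0, Real.cos t, -Real.sin t, 0; 0, Real.sin t, Real.cos t, 0; 0, 0, 0, 1]

theorem rotationMatrix_mul_neg (t : ℝ) : rotationMatrix t * rotationMatrix (-t) = 1 := by
  have := Real.sin_sq_add_cos_sq t
  ext i j
  fin_cases i <;> fin_cases j <;>
    simp [rotationMatrix, Matrix.mul_apply, Fin.sum_univ_four] <;> nlinarith

theorem rotationMatrix_isometry (t : ℝ) :
    (rotationMatrix t)ᵀ * minkowskiMetric * rotationMatrix t = minkowskiMetric := by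
  have := Real.sin_sq_add_cos_sq t
  ext i j
  fin_cases i <;> fin_cases j <;>
    simp [rotationMatrix, minkowskiMetric, Matrix.mul_apply, Fin.sum_univ_four,
      Matrix.diagonal_apply] <;> nlinarith

/-- The rotation by the angle `t` in the `(x₁, x₂)` plane, in the Lorentz group. -/
def rotationFull (t : ℝ) : lorentzGroup :=
  mkLorentz (rotationMatrix t) (rotationMatrix (-t)) (rotationMatrix_mul_neg t)
    (by simpa using rotationMatrix_mul_neg (-t)) (rotationMatrix_isometry t)

theorem continuous_rotationMatrix : Continuous rotationMatrix := by
  refine continuous_matrix fun i j => ?_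
  fin_cases i <;> fin_cases j <;> simp [rotationMatrix] <;> fun_prop

theorem continuous_rotationFull : Continuous rotationFull := by
  refine Continuous.subtype_mk (f := fun t => (rotationFull t : GL (Fin 4) ℝ))
    (Units.continuous_iff.2 ⟨continuous_rotationMatrix, ?_⟩) _
  exact continuous_rotationMatrix.comp continuous_neg

theorem rotationFull_zero : rotationFull 0 = 1 := by
  refine Subtype.ext (Units.ext ?_)
  change rotationMatrix 0 = 1
  ext i j; fin_cases i <;> fin_cases j <;> simp [rotationMatrix]

/-- The rotations in the `(x₁, x₂)` plane in the proper orthochronous Lorentz group. -/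
def spaceRotation (t : ℝ) : properLorentz :=
  ⟨rotationFull t, mem_properLorentz_of_path _ continuous_rotationFull rotationFull_zero t⟩

/-- The causal complement of a region: the interior of the set of the points that are spacelike
separated from all its points. -/
def causalComplement (O : Set Spacetime) : Set Spacetime :=
  interior {x | ∀ y ∈ O, minkowskiSq (x - y) < 0}

/-- The right wedge `W₁ = {x | |x₀| < x₁}`. -/
def rightWedge : Set Spacetime := {x | |x 0| < x 1}

/-- Wedges: the regions `g W₁` with `g` in the proper orthochronous Poincaré group. -/
def Wedge : Type := {W : Set Spacetime // ∃ g : Poincare, W = g • rightWedge}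

theorem minkowskiSq_eq (x : Spacetime) :
    minkowskiSq x = x 0 ^ 2 - x 1 ^ 2 - x 2 ^ 2 - x 3 ^ 2 := by
  simp [minkowskiSq, minkowskiMetric, Matrix.mulVec_diagonal, dotProduct, Fin.sum_univ_four]
  ring

theorem causalComplement_smul (g : Poincare) (O : Set Spacetime) :
    causalComplement (g • O) = g • causalComplement O := by
  unfold causalComplement
  rw [← interior_smul]
  congr 1
  ext x
  rw [Set.mem_smul_set_iff_inv_smul_mem]
  simp only [Set.mem_ofPred_eq]
  constructor
  · intro h y hy
    have := h (g • y) (Set.smul_mem_smul_set hy)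
    rwa [← poincare_smul_sub g, smul_inv_smul]
  · rintro h _ ⟨y, hy, rfl⟩
    have := h y hy
    rwa [← poincare_smul_sub g, smul_inv_smul] at this

theorem causalComplement_rightWedge :
    causalComplement rightWedge = {x : Spacetime | x 1 < -|x 0|} := by
  have key : ∀ x : Spacetime, (∀ y ∈ rightWedge, minkowskiSq (x - y) < 0) → x 1 ≤ -|x 0| := by
    intro x hx
    by_contra! hlt
    have hS : ∀ σ : ℝ, (σ = 1 ∨ σ = -1) → 0 < σ * x 0 + x 1 → False := by
      intro σ hσ hpos
      let s : ℝ := |x 0| + |x 1| + 1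
      have hy := hx ![x 0 - σ * s, x 1 + s, x 2, x 3] (by
        change |x 0 - σ * s| < x 1 + s
        have a1 := abs_le.1 (le_refl |x 0|)
        have a2 := abs_le.1 (le_refl |x 1|)
        rw [abs_lt]
        rcases hσ with rfl | rfl <;> constructor <;> simp only [s] <;> linarith)
      rw [minkowskiSq_eq] at hy
      simp at hy
      rcases hσ with rfl | rfl <;> linarith
    rcases le_total 0 (x 0) with h0 | h0
    · rw [abs_of_nonneg h0] at hlt
      exact hS 1 (Or.inl rfl) (by linarith)
    · rw [abs_of_nonpos h0] at hlt
      exact hS (-1) (Or.inr rfl) (by linarith)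
  apply Set.Subset.antisymm
  · intro x hx
    have hcont : Filter.Tendsto (fun ε : ℝ => x + ε • Pi.single (1 : Fin 4) (1 : ℝ))
        (nhdsWithin 0 (Set.Ioi 0)) (nhds x) := by
      have : Continuous fun ε : ℝ => x + ε • (Pi.single (1 : Fin 4) (1 : ℝ) : Spacetime) := by
        fun_prop
      have h := this.tendsto 0
      simp only [zero_smul, add_zero] at h
      exact h.mono_left nhdsWithin_le_nhds
    have hev := hcont.eventually (mem_interior_iff_mem_nhds.1 hx)
    obtain ⟨ε, hε, hpos⟩ := (hev.and self_mem_nhdsWithin).exists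
    have := key _ hε
    simp at this
    have hp : 0 < ε := hpos
    change x 1 < -|x 0|
    linarith
  · refine interior_maximal ?_ ?_
    · intro x hx y hy
      have hx' : x 1 < -|x 0| := hx
      have hy' : |y 0| < y 1 := hy
      rw [minkowskiSq_eq]
      have h1 : |x 0 - y 0| < y 1 - x 1 := by
        calc |x 0 - y 0| ≤ |x 0| + |y 0| := abs_sub _ _
          _ < _ := by linarith
      have h2 := sq_lt_sq' (abs_lt.1 h1).1 (abs_lt.1 h1).2
      simp only [Pi.sub_apply]
      nlinarith [sq_nonneg (x 2 - y 2), sq_nonneg (x 3 - y 3)]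
    · exact isOpen_lt (by fun_prop) (by fun_prop)

theorem spaceRotation_smul_rightWedge :
    lorentz (spaceRotation Real.pi) • rightWedge = {x : Spacetime | x 1 < -|x 0|} := by
  have hmat : ∀ x : Spacetime, lorentz (spaceRotation Real.pi) • x = ![x 0, -x 1, -x 2, x 3] := by
    intro x
    change rotationMatrix Real.pi *ᵥ x + 0 = _
    ext i
    fin_cases i <;> simp [rotationMatrix, dotProduct, Fin.sum_univ_four]
  ext x
  constructor
  · rintro ⟨y, hy, rfl⟩
    have hy' : |y 0| < y 1 := hy
    simp only [hmat]
    change -y 1 < -|y 0|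
    linarith
  · intro hx
    have hx' : x 1 < -|x 0| := hx
    refine ⟨![x 0, -x 1, -x 2, x 3], ?_, ?_⟩
    · change |x 0| < -x 1
      linarith
    · simp only [hmat]
      ext i
      fin_cases i <;> simp

namespace Wedge

instance : MulAction Poincare Wedge where
  smul g W := ⟨g • W.1, by
    obtain ⟨h, hh⟩ := W.2
    exact ⟨g * h, by rw [hh, mul_smul]⟩⟩
  one_smul W := Subtype.ext (one_smul Poincare W.1)
  mul_smul g h W := Subtype.ext (mul_smul g h W.1)

/-- The wedge `W'`, the causal complement of the wedge `W`. -/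
def compl (W : Wedge) : Wedge :=
  ⟨causalComplement W.1, by
    obtain ⟨g, hg⟩ := W.2
    refine ⟨g * lorentz (spaceRotation Real.pi), ?_⟩
    rw [hg, causalComplement_smul, causalComplement_rightWedge, mul_smul,
      spaceRotation_smul_rightWedge]⟩

/-- The one-parameter group of boosts `Λ_W(t) = g Λ_{W₁}(t) g⁻¹` of a wedge `W = g W₁`. The
stabilizer of `W₁` commutes with the boosts `Λ_{W₁}(t)`, so `g` may be chosen at will. -/
def boosts (W : Wedge) (t : ℝ) : Poincare :=
  W.2.choose * lorentz (boost t) * W.2.choose⁻¹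

end Wedge

end Minkowski

noncomputable section Nets

open Complex
open scoped ComplexInnerProductSpace

/-- The closed forward light cone. -/
def forwardCone : Set Spacetime := {a | 0 ≤ a 0 ∧ 0 ≤ minkowskiSq a}

/-- A strongly continuous unitary representation of the proper orthochronous Poincaré group with
positive energy: for every `a` in the closed forward cone, the self-adjoint generator `P_a` of the
translations `U(s a) = exp(i s P_a)` is positive. If `φ` is the derivative of `s ↦ U(s a) ψ` at `0`
then `ψ` is in the domain of `P_a` and `P_a ψ = -i φ`. -/
structure PositiveEnergyRep (H : Type*) [NormedAddCommGroup H] [InnerProductSpace ℂ H]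
    [CompleteSpace H] where
  toHom : Poincare →* unitary (H →L[ℂ] H)
  continuous : ∀ ψ : H, Continuous fun p : Spacetime × properLorentz =>
    (toHom (poincare p.1 p.2) : H →L[ℂ] H) ψ
  positive_energy : ∀ a ∈ forwardCone, ∀ ψ φ : H,
    HasDerivAt (fun s : ℝ => (toHom (translation (s • a)) : H →L[ℂ] H) ψ) φ 0 →
      0 ≤ (⟪ψ, -I • φ⟫).re

/-- The unitary operator `U(g)`. -/
def PositiveEnergyRep.op {H : Type*} [NormedAddCommGroup H] [InnerProductSpace ℂ H]
    [CompleteSpace H] (U : PositiveEnergyRep H) (g : Poincare) : H →L[ℂ] H :=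
  (U.toHom g : H →L[ℂ] H)

/-- A local Poincaré covariant net of standard subspaces on wedges. -/
structure CovariantNet {H : Type*} [NormedAddCommGroup H] [InnerProductSpace ℂ H]
    [CompleteSpace H] (U : PositiveEnergyRep H) where
  space : Wedge → ClosedSubmodule ℝ H
  isotony : ∀ W₁ W₂ : Wedge, W₁.1 ⊆ W₂.1 → space W₁ ≤ space W₂
  covariance : ∀ (W : Wedge) (g : Poincare),
    U.op g '' (space W : Set H) = (space (g • W) : Set H)
  cyclic : ∀ W : Wedge, space W ⊔ (space W).mulI = ⊤
  locality : ∀ W₁ W₂ : Wedge, W₁.1 ⊆ W₂.compl.1 → space W₁ ≤ (space W₂).symplComp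

namespace CovariantNet

open ClosedSubmodule

variable {H : Type*} [NormedAddCommGroup H] [InnerProductSpace ℂ H] [CompleteSpace H]
  {U : PositiveEnergyRep H}

theorem separating (N : CovariantNet U) (W : Wedge) :
    N.space W ⊓ (N.space W).mulI = ⊥ := by
  have h1 : N.space W.compl ≤ (N.space W).symplComp := N.locality _ _ subset_rfl
  have h2 : (N.space W).symplComp ⊔ (N.space W).symplComp.mulI = ⊤ := by
    rw [eq_top_iff, ← N.cyclic W.compl]
    refine sup_le_sup h1 fun x hx => ?_
    rw [mem_mapEquiv_iff] at hx ⊢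
    exact h1 hx
  rw [← symplComp_symplComp_eq (S := N.space W ⊓ (N.space W).mulI), symplComp_inf,
    ← mulI_symplComp, h2]
  refine le_bot_iff.1 fun x hx => ?_
  have hx' := mem_symplComp_iff.1 hx (I • x) trivial
  have h3 : ‖x‖ ^ 2 = 0 := by
    rw [inner_smul_left, inner_self_eq_norm_sq_to_K] at hx'
    simpa [← ofReal_pow] using hx'
  simpa using h3

/-- The subspace `H(W)`, which is standard: it is separating by locality and cyclicity. -/
def standard (N : CovariantNet U) (W : Wedge) : StandardSubspace H :=
  ⟨N.space W, N.separating W, N.cyclic W⟩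

/-- The operators `Z_{H(W)}(t) = Δ_{H(W)}^{it} U(Λ_W(2πt))`. -/
def Z (N : CovariantNet U) (W : Wedge) (t : ℝ) : H →L[ℂ] H :=
  (N.standard W).modularGroup t * U.op (W.boosts (2 * Real.pi * t))

/-- The Bisognano–Wichmann property: `U(Λ_W(2πt)) = Δ_{H(W)}^{-it}`. -/
def BisognanoWichmann (N : CovariantNet U) : Prop :=
  ∀ (W : Wedge) (t : ℝ),
    U.op (W.boosts (2 * Real.pi * t)) = (N.standard W).modularGroup (-t)

/-- Wedge duality: `H(W) = H(W')'`. -/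
def WedgeDuality (N : CovariantNet U) : Prop :=
  ∀ W : Wedge, N.space W = (N.space W.compl).symplComp

end CovariantNet

end Nets

/-!
Write `K = H(W)`, `Δ` for its modular operator and `L = H(W') = U(r) K`. Since `r` reverses the
boosts of `W`, the commutation of `Δ^{it} U(Λ_W(2πt))` with `U(r)` says that
`Δ_L^{it} = Δ^{it} U(Λ_W(4πt))`. Boosts preserve `L`, hence so does `Δ^{it}`, which up to the sign
of `t` is the modular group of `K'`. A standard subspace `L ⊆ K'` invariant under the modular group
of `K'` equals `K'`. This is wedge duality, and comparing the two expressions for the modular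
group of `L = K'` yields `Δ^{-it} = Δ^{it} U(Λ_W(4πt))`, the Bisognano–Wichmann property at `W`.
The Poincaré group is transitive on wedges and compatible with complements and boosts.

Modular groups are only given by bounded functional calculus, so invariance is transported between
`Δ^{it}` and the bounded operator `i(1 - 2B)`, where `B = (1 + Δ)⁻¹`. On a subspace of `K` the
latter is `ξ ↦ -P(iξ)`, with `P` the real orthogonal projection onto `K`. So if it maps a standard
`L ⊆ K` into itself, a vector of `K` that is real orthogonal to `L` is also real orthogonal to
`iL`, and hence vanishes.
-/

noncomputable section Approximation

open Complex Polynomial Set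
open scoped ComplexConjugate

theorem exists_real_polynomial_aeval_eq (p : ℂ[X]) :
    ∃ q : ℝ[X], ∀ z : ℂ, aeval z q = (p.eval z + conj (p.eval (conj z))) / 2 := by
  obtain ⟨q, hq⟩ : ∃ q : ℝ[X],
      q.map (algebraMap ℝ ℂ) = C (1 / 2) * (p + p.map (starRingEnd ℂ)) := by
    refine (lifts_iff_coeff_lifts _).2 fun n => ⟨(p.coeff n).re, ?_⟩
    simp [add_conj]
  refine ⟨q, fun z => ?_⟩
  have hconj : (p.map (starRingEnd ℂ)).eval z = conj (p.eval (conj z)) := by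
    rw [eval_map, ← eval₂_at_apply, conj_conj]
  rw [← aeval_map_algebraMap ℂ, hq, coe_aeval_eq_eval, eval_mul, eval_C, eval_add, hconj]
  ring

theorem exists_complex_polynomial_near {h : ℝ → ℂ} {a b : ℝ} (hc : ContinuousOn h (Icc a b))
    {ε : ℝ} (hε : 0 < ε) : ∃ p : ℂ[X], ∀ u ∈ Icc a b, ‖p.eval (u : ℂ) - h u‖ ≤ ε := by
  obtain ⟨p, hp⟩ := exists_polynomial_near_of_continuousOn a b (fun u => (h u).re)
    (continuous_re.comp_continuousOn hc) (ε / 2) (by positivity)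
  obtain ⟨q, hq⟩ := exists_polynomial_near_of_continuousOn a b (fun u => (h u).im)
    (continuous_im.comp_continuousOn hc) (ε / 2) (by positivity)
  refine ⟨p.map ofRealHom + C I * q.map ofRealHom, fun u hu => ?_⟩
  have heval (r : ℝ[X]) : (r.map ofRealHom).eval (u : ℂ) = (r.eval u : ℝ) :=
    eval_map_apply ofRealHom u
  refine (norm_le_abs_re_add_abs_im _).trans ?_
  simpa [heval] using (add_lt_add (hp u hu) (hq u hu)).le

theorem exists_real_polynomial_near {h : ℝ → ℂ} (hc : ContinuousOn h (Icc (-1) 1))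
    (hsymm : ∀ u ∈ Icc (-1 : ℝ) 1, h (-u) = conj (h u)) {ε : ℝ} (hε : 0 < ε) :
    ∃ q : ℝ[X], ∀ u ∈ Icc (-1 : ℝ) 1, ‖aeval (I * u : ℂ) q - h u‖ ≤ ε := by
  obtain ⟨p, hp⟩ := exists_complex_polynomial_near hc hε
  obtain ⟨q, hq⟩ := exists_real_polynomial_aeval_eq (p.comp (C (-I) * X))
  refine ⟨q, fun u hu => ?_⟩
  have hu' : -u ∈ Icc (-1 : ℝ) 1 := by rwa [neg_mem_Icc_iff, neg_neg]
  have hsplit : aeval (I * u : ℂ) q - h u =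
      ((p.eval (u : ℂ) - h u) + conj (p.eval ((-u : ℝ) : ℂ) - h (-u))) / 2 := by
    have hpos : -I * (I * u) = (u : ℂ) := by linear_combination (-u : ℂ) * I_mul_I
    have hneg : -I * conj (I * u : ℂ) = ((-u : ℝ) : ℂ) := by
      rw [map_mul, conj_I, conj_ofReal]; push_cast; linear_combination (u : ℂ) * I_mul_I
    simp only [hq, eval_comp, eval_mul, eval_C, eval_X, hpos, hneg, hsymm u hu, map_sub, conj_conj]
    ring
  rw [hsplit, norm_div, RCLike.norm_ofNat]
  have hle := norm_add_le (p.eval (u : ℂ) - h u) (conj (p.eval ((-u : ℝ) : ℂ) - h (-u)))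
  rw [RCLike.norm_conj] at hle
  linarith [hp u hu, hp (-u) hu']

end Approximation

noncomputable section ModularTheory

namespace TomitaTakesaki

open Complex ClosedSubmodule StandardSubspace Polynomial Set Filter
open scoped Topology ComplexConjugate ComplexOrder ComplexInnerProductSpace InnerProduct

variable {H : Type*} [NormedAddCommGroup H] [InnerProductSpace ℂ H]

section RealCommutant

/-- The complex linear operators commuting with a real linear operator `T`. They form only a real
algebra, since `T` need not commute with the scalar `i`. -/
def realCommutant (T : H →L[ℝ] H) : Subalgebra ℝ (H →L[ℂ] H) where
  carrier := {A | ∀ x, T (A x) = A (T x)}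
  mul_mem' hA hB x := by
    simp only [mul_apply_eq_comp]
    rw [hA, hB]
  add_mem' hA hB x := by
    simp only [add_apply, map_add]
    rw [hA, hB]
  algebraMap_mem' c x := by simp [Algebra.algebraMap_eq_smul_one]

theorem mem_realCommutant {T : H →L[ℝ] H} {A : H →L[ℂ] H} :
    A ∈ realCommutant T ↔ ∀ x, T (A x) = A (T x) := Iff.rfl

theorem eq_of_mul_eq_of_denseRange {A B M : H →L[ℂ] H} (hM : DenseRange M) (h : A * M = B * M) :
    A = B :=
  ContinuousLinearMap.coeFn_injective <|
    hM.equalizer A.continuous B.continuous (funext fun y => congr($h y))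

theorem mem_realCommutant_of_mul_mem {T : H →L[ℝ] H} {A M : H →L[ℂ] H} (hM : DenseRange M)
    (hMT : M ∈ realCommutant T) (hAM : A * M ∈ realCommutant T) : A ∈ realCommutant T := by
  refine mem_realCommutant.2 (congrFun <| hM.equalizer (T.continuous.comp A.continuous)
    (A.continuous.comp T.continuous) <| funext fun y => ?_)
  have h := mem_realCommutant.1 hAM y
  simpa only [mul_apply_eq_comp, Function.comp_apply, mem_realCommutant.1 hMT y] using h

/-- Approximations of `A` are only needed after multiplication by `M`, although `M` itself need not
commute with `T`: the relation `M T A M = A M T M` passes to the limit. -/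
theorem mem_realCommutant_of_mul_mem_closure {T : H →L[ℝ] H} {A M : H →L[ℂ] H}
    (hinj : Function.Injective M) (hdense : DenseRange M) (hcomm : Commute A M)
    (hcl : A * M ∈ closure {B | ∃ S ∈ realCommutant T, Commute S M ∧ S * M = B}) :
    A ∈ realCommutant T := by
  have hclosed : IsClosed {B : H →L[ℂ] H | ∀ y, M (T (B y)) = B (T (M y))} := by
    simp only [ofPred_forall]
    exact isClosed_iInter fun y => isClosed_eq
      (M.continuous.comp (T.continuous.comp (ContinuousLinearMap.apply ℂ H y).continuous))
      (ContinuousLinearMap.apply ℂ H (T (M y))).continuous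
  have hlim : ∀ y, M (T ((A * M) y)) = (A * M) (T (M y)) := by
    refine closure_minimal ?_ hclosed hcl
    rintro _ ⟨S, hS, hSM, rfl⟩ y
    rw [mul_apply_eq_comp, mem_realCommutant.1 hS, ← mul_apply_eq_comp, hSM.eq]
  refine mem_realCommutant.2 (congrFun <| hdense.equalizer (T.continuous.comp A.continuous)
    (A.continuous.comp T.continuous) <| funext fun y => hinj ?_)
  have hMA (z : H) : M (A z) = A (M z) := congr($hcomm.eq z).symm
  simpa only [mul_apply_eq_comp, Function.comp_apply, hMA] using hlim y

end RealCommutant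

section Symbol

variable [CompleteSpace H]

theorem vanishesAtEnds_mul_of_bounded {f m : ℝ → ℂ} (hf : VanishesAtEnds f) {C : ℝ}
    (hm : ContinuousOn m (Ioi 0)) (hC : ∀ x, 0 < x → ‖m x‖ ≤ C) :
    VanishesAtEnds fun x => m x * f x := by
  have hle (x : ℝ) : ‖m x * f x‖ ≤ C * ‖f x‖ := by
    rcases le_or_gt x 0 with hx | hx
    · simp [hf.eq_zero x hx]
    · exact (norm_mul_le _ _).trans (by gcongr; exact hC x hx)
  refine ⟨continuous_iff_continuousAt.2 fun x => ?_, fun x hx => by simp [hf.eq_zero x hx], ?_⟩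
  · rcases le_or_gt x 0 with hx | hx
    · have hz := hf.eq_zero x hx
      rw [ContinuousAt, hz, mul_zero]
      refine squeeze_zero_norm hle ?_
      simpa [hz] using (hf.continuous.norm.tendsto x).const_mul C
    · exact (hm.continuousAt (Ioi_mem_nhds hx)).mul hf.continuous.continuousAt
  · exact squeeze_zero_norm hle (by simpa using hf.tendsto.norm.const_mul C)

theorem vanishesAtEnds_add {f g : ℝ → ℂ} (hf : VanishesAtEnds f) (hg : VanishesAtEnds g) :
    VanishesAtEnds fun x => f x + g x :=
  ⟨hf.continuous.add hg.continuous, fun x hx => by simp [hf.eq_zero x hx, hg.eq_zero x hx],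
    by simpa using hf.tendsto.add hg.tendsto⟩

theorem isStarNormal_modularResolvent (K : StandardSubspace H) : IsStarNormal K.modularResolvent :=
  K.modularResolvent_isPositive.isSelfAdjoint.isStarNormal

theorem continuousOn_spectrum_modularResolvent (K : StandardSubspace H) {f : ℝ → ℂ}
    (hf : VanishesAtEnds f) :
    ContinuousOn (fun z : ℂ => f (z.re⁻¹ - 1)) (spectrum ℂ K.modularResolvent) :=
  hf.continuousOn.mono fun _ hz => (K.modularResolvent_spectrum hz).2.1

theorem modularFunction_add (K : StandardSubspace H) {f g : ℝ → ℂ} (hf : VanishesAtEnds f)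
    (hg : VanishesAtEnds g) :
    K.modularFunction (fun x => f x + g x) = K.modularFunction f + K.modularFunction g :=
  cfc_add _ _ _ (continuousOn_spectrum_modularResolvent K hf)
    (continuousOn_spectrum_modularResolvent K hg)

theorem modularFunction_const_mul (K : StandardSubspace H) (c : ℂ) {f : ℝ → ℂ}
    (hf : VanishesAtEnds f) :
    K.modularFunction (fun x => c * f x) = c • K.modularFunction f :=
  cfc_const_mul _ _ _ (continuousOn_spectrum_modularResolvent K hf)

theorem norm_modularFunction_le (K : StandardSubspace H) {f : ℝ → ℂ} {C : ℝ} (hC : 0 ≤ C)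
    (hf : ∀ x, ‖f x‖ ≤ C) : ‖K.modularFunction f‖ ≤ C :=
  norm_cfc_le hC fun _ _ => hf _

/-- `A = m(Δ_K)` for a function `m` on `(0, ∞)` that need not vanish at the ends: such an `A` is
determined by its products with the operators `f(Δ_K)`. The values of `m` on `(-∞, 0]` are
irrelevant. -/
structure HasSymbol (K : StandardSubspace H) (A : H →L[ℂ] H) (m : ℝ → ℂ) : Prop where
  vanishesAtEnds {f : ℝ → ℂ} (hf : VanishesAtEnds f) : VanishesAtEnds fun x => m x * f x
  mul_modularFunction {f : ℝ → ℂ} (hf : VanishesAtEnds f) :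
    A * K.modularFunction f = K.modularFunction fun x => m x * f x

namespace HasSymbol

variable {K : StandardSubspace H} {A B : H →L[ℂ] H} {m n : ℝ → ℂ}

theorem modularFunction (K : StandardSubspace H) {f : ℝ → ℂ} (hf : VanishesAtEnds f) :
    HasSymbol K (K.modularFunction f) f where
  vanishesAtEnds hg :=
    ⟨hf.continuous.mul hg.continuous, fun x hx => by simp [hf.eq_zero x hx],
      by simpa using hf.tendsto.mul hg.tendsto⟩
  mul_modularFunction hg := (modularFunction_mul K hf hg).symm

theorem modularGroup (K : StandardSubspace H) (t : ℝ) :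
    HasSymbol K (K.modularGroup t) fun x => (x : ℂ) ^ (I * t) where
  vanishesAtEnds hf := hf.cpow_mul t
  mul_modularFunction hf := K.modularGroup_spec t _ hf

theorem const (K : StandardSubspace H) (c : ℂ) :
    HasSymbol K (algebraMap ℂ (H →L[ℂ] H) c) fun _ => c where
  vanishesAtEnds hf := vanishesAtEnds_mul_of_bounded hf continuousOn_const fun _ _ => le_rfl
  mul_modularFunction hf := by rw [modularFunction_const_mul K c hf, Algebra.smul_def]

theorem add (hA : HasSymbol K A m) (hB : HasSymbol K B n) :
    HasSymbol K (A + B) fun x => m x + n x where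
  vanishesAtEnds hf := by
    simpa only [add_mul] using vanishesAtEnds_add (hA.vanishesAtEnds hf) (hB.vanishesAtEnds hf)
  mul_modularFunction hf := by
    simp only [add_mul, hA.mul_modularFunction hf, hB.mul_modularFunction hf,
      modularFunction_add K (hA.vanishesAtEnds hf) (hB.vanishesAtEnds hf)]

theorem mul (hA : HasSymbol K A m) (hB : HasSymbol K B n) :
    HasSymbol K (A * B) fun x => m x * n x where
  vanishesAtEnds hf := by
    simpa only [mul_assoc] using hA.vanishesAtEnds (hB.vanishesAtEnds hf)
  mul_modularFunction hf := by
    simp only [mul_assoc, hB.mul_modularFunction hf,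
      hA.mul_modularFunction (hB.vanishesAtEnds hf)]

theorem const_smul (c : ℂ) (hA : HasSymbol K A m) : HasSymbol K (c • A) fun x => c * m x := by
  simpa only [Algebra.smul_def] using (const K c).mul hA

theorem sub (hA : HasSymbol K A m) (hB : HasSymbol K B n) :
    HasSymbol K (A - B) fun x => m x - n x := by
  simpa [sub_eq_add_neg] using hA.add (hB.const_smul (-1))

theorem aeval (hA : HasSymbol K A m) (q : ℝ[X]) :
    HasSymbol K (Polynomial.aeval A q) fun x => Polynomial.aeval (m x) q := by
  induction q using Polynomial.induction_on with
  | C c => simpa [← Complex.coe_algebraMap, ← IsScalarTower.algebraMap_apply] using const K (c : ℂ)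
  | add p q hp hq => simpa only [map_add] using hp.add hq
  | monomial n c h => simpa only [pow_succ, ← mul_assoc, map_mul, aeval_X] using h.mul hA

theorem congr (hA : HasSymbol K A m) (h : ∀ x, 0 < x → m x = n x) : HasSymbol K A n := by
  have hmn {f : ℝ → ℂ} (hf : VanishesAtEnds f) : (fun x => n x * f x) = fun x => m x * f x := by
    funext x
    rcases le_or_gt x 0 with hx | hx
    · simp [hf.eq_zero x hx]
    · rw [h x hx]
  exact ⟨fun hf => hmn hf ▸ hA.vanishesAtEnds hf, fun hf => hmn hf ▸ hA.mul_modularFunction hf⟩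

theorem unique (hA : HasSymbol K A m) (hB : HasSymbol K B m) : A = B :=
  eq_of_mul_eq_of_denseRange K.modularFunction_bump_denseRange <|
    (hA.mul_modularFunction bump_vanishesAtEnds).trans
      (hB.mul_modularFunction bump_vanishesAtEnds).symm

theorem commute (hA : HasSymbol K A m) (hB : HasSymbol K B n) : Commute A B :=
  (hA.mul hB).unique (by simpa only [mul_comm] using hB.mul hA)

theorem norm_mul_modularFunction_le (hA : HasSymbol K A m) {f : ℝ → ℂ} (hf : VanishesAtEnds f)
    {δ : ℝ} (hδ : 0 ≤ δ) (h : ∀ x, 0 < x → ‖m x‖ * ‖f x‖ ≤ δ) :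
    ‖A * K.modularFunction f‖ ≤ δ := by
  rw [hA.mul_modularFunction hf]
  refine norm_modularFunction_le K hδ fun x => ?_
  rcases le_or_gt x 0 with hx | hx
  · simpa [hf.eq_zero x hx]
  · simpa only [norm_mul] using h x hx

end HasSymbol

theorem hasSymbol_modularResolvent (K : StandardSubspace H) :
    HasSymbol K K.modularResolvent fun x => (1 + x : ℂ)⁻¹ where
  vanishesAtEnds hf := by
    refine vanishesAtEnds_mul_of_bounded (C := 1) hf (fun x hx => ?_) fun x hx => ?_
    · have hne : (1 + x : ℂ) ≠ 0 := by exact_mod_cast (by linarith [mem_Ioi.1 hx] : 1 + x ≠ 0)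
      have hc : Continuous fun x : ℝ => (1 + x : ℂ) := by fun_prop
      exact (hc.continuousAt.inv₀ hne).continuousWithinAt
    · rw [norm_inv, ← ofReal_one, ← ofReal_add, norm_real, Real.norm_of_nonneg (by positivity)]
      exact inv_le_one_of_one_le₀ (by linarith)
  mul_modularFunction {f} hf := by
    have hB := isStarNormal_modularResolvent K
    have hmul : K.modularResolvent * K.modularFunction f =
        cfc (fun z : ℂ => z * f (z.re⁻¹ - 1)) K.modularResolvent := by
      rw [cfc_mul (fun z => z) _ _ continuousOn_id (continuousOn_spectrum_modularResolvent K hf),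
        cfc_id' ℂ K.modularResolvent, StandardSubspace.modularFunction]
    rw [hmul]
    refine cfc_congr fun z hz => ?_
    have hz' : (1 + ((z.re⁻¹ - 1 : ℝ) : ℂ))⁻¹ = z := by
      push_cast
      rw [add_sub_cancel, inv_inv, ← (K.modularResolvent_spectrum hz).1]
    exact congr($hz'.symm * _)

theorem injective_modularFunction_bump (K : StandardSubspace H) :
    Function.Injective (K.modularFunction bump) := by
  have hsa : IsSelfAdjoint (K.modularFunction bump) := by
    have hB := K.modularResolvent_isPositive.isSelfAdjoint
    rw [modularFunction_bump]
    exact (hB.commute_iff ((IsSelfAdjoint.one _).sub hB)).1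
      ((Commute.one_right _).sub_right (Commute.refl _))
  refine (injective_iff_map_eq_zero _).2 fun x hx => ?_
  refine K.modularFunction_bump_denseRange.eq_zero_of_inner_right ℂ ?_
  intro y
  rw [← hsa.adjoint_eq, ContinuousLinearMap.adjoint_inner_left, hx, inner_zero_right]

theorem norm_bump_le {x : ℝ} (hx : 0 < x) : ‖bump x‖ ≤ Real.exp (-|Real.log x|) := by
  rw [bump, if_neg hx.not_ge, norm_real, Real.norm_of_nonneg (by positivity)]
  rcases le_total 1 x with h | h
  · rw [abs_of_nonneg (Real.log_nonneg h), Real.exp_neg, Real.exp_log hx, inv_eq_one_div,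
      div_le_div_iff₀ (by positivity) hx]
    nlinarith
  · rw [abs_of_nonpos (Real.log_nonpos hx.le h), neg_neg, Real.exp_log hx]
    exact div_le_self hx.le (by nlinarith)

end Symbol

section SkewSymbol

variable [CompleteSpace H] {K : StandardSubspace H} {T : H →L[ℝ] H}

/-- The polynomials `q (i v)` with real coefficients stay in the real algebra `realCommutant T`,
and by conjugation symmetry they are dense enough to reach `h ∘ v`. The weight `bump` makes the
approximation insensitive to the behaviour of `m` at `0` and `∞`. -/
theorem mem_realCommutant_of_symbol_approx {A : H →L[ℂ] H} {m : ℝ → ℂ} (hA : HasSymbol K A m)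
    (happrox : ∀ δ > 0, ∃ S ∈ realCommutant T, ∃ (v : ℝ → ℝ) (h : ℝ → ℂ),
      HasSymbol K S (fun x => I * v x) ∧ (∀ x, 0 < x → v x ∈ Icc (-1) 1) ∧
      ContinuousOn h (Icc (-1) 1) ∧ (∀ u ∈ Icc (-1 : ℝ) 1, h (-u) = conj (h u)) ∧
      ∀ x, 0 < x → ‖m x - h (v x)‖ * ‖bump x‖ ≤ δ) :
    A ∈ realCommutant T := by
  have hbump := HasSymbol.modularFunction K bump_vanishesAtEnds
  refine mem_realCommutant_of_mul_mem_closure (injective_modularFunction_bump K)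
    K.modularFunction_bump_denseRange (hA.commute hbump) ?_
  refine Metric.mem_closure_iff.2 fun ε hε => ?_
  obtain ⟨S, hS, v, h, hSv, hv, hc, hsymm, hm⟩ := happrox (ε / 4) (by positivity)
  obtain ⟨q, hq⟩ := exists_real_polynomial_near hc hsymm (ε := ε / 4) (by positivity)
  have hqS := hSv.aeval q
  have hqT : aeval S q ∈ realCommutant T :=
    aeval_algHom_apply (realCommutant T).val ⟨S, hS⟩ q ▸ SetLike.coe_mem _
  refine ⟨_, ⟨aeval S q, hqT, hqS.commute hbump, rfl⟩, ?_⟩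
  rw [dist_eq_norm, ← sub_mul]
  refine ((hA.sub hqS).norm_mul_modularFunction_le bump_vanishesAtEnds
    (δ := ε / 2) (by positivity) fun x hx => ?_).trans_lt (half_lt_self hε)
  have hb : ‖bump x‖ ≤ 1 := (norm_bump_le hx).trans (Real.exp_le_one_iff.2 (by simp))
  calc ‖m x - aeval (I * v x : ℂ) q‖ * ‖bump x‖
      ≤ (‖m x - h (v x)‖ + ‖h (v x) - aeval (I * v x : ℂ) q‖) * ‖bump x‖ := by
        gcongr; exact norm_sub_le_norm_sub_add_norm_sub _ _ _
    _ = ‖m x - h (v x)‖ * ‖bump x‖ + ‖aeval (I * v x : ℂ) q - h (v x)‖ * ‖bump x‖ := by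
        rw [add_mul, norm_sub_rev (h _)]
    _ ≤ ε / 4 + ε / 4 * 1 := by gcongr; exacts [hm x hx, hq _ (hv x hx)]
    _ = ε / 2 := by ring

/-- The skew-adjoint operator `i (Δ_K - 1) (Δ_K + 1)⁻¹ = i (1 - 2 (1 + Δ_K)⁻¹)`. It carries the
same information as `Δ_K` but, unlike `Δ_K`, commutes with the real orthogonal projection
onto `K`. -/
def skew (K : StandardSubspace H) : H →L[ℂ] H := I • (1 - (2 : ℂ) • K.modularResolvent)

theorem mem_Icc_one_sub_two_mul_inv {x : ℝ} (hx : 0 < x) :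
    1 - 2 * (1 + x)⁻¹ ∈ Icc (-1) 1 := by
  have h0 : 0 < (1 + x)⁻¹ := by positivity
  have h1 : (1 + x)⁻¹ ≤ 1 := inv_le_one_of_one_le₀ (by linarith)
  constructor <;> linarith

theorem hasSymbol_skew (K : StandardSubspace H) :
    HasSymbol K (skew K) fun x => I * (1 - 2 * (1 + x : ℝ)⁻¹ : ℝ) := by
  simpa [skew] using
    ((HasSymbol.const K 1).sub ((hasSymbol_modularResolvent K).const_smul 2)).const_smul I

theorem modularFunction_mem_realCommutant (hT : skew K ∈ realCommutant T) {f : ℝ → ℂ}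
    (hf : VanishesAtEnds f) (hsymm : ∀ x, 0 < x → f x⁻¹ = conj (f x)) :
    K.modularFunction f ∈ realCommutant T := by
  refine mem_realCommutant_of_symbol_approx (.modularFunction K hf) fun δ hδ =>
    ⟨skew K, hT, _, fun u => f (((1 - u) / 2)⁻¹ - 1), hasSymbol_skew K,
      fun _ => mem_Icc_one_sub_two_mul_inv, ?_, ?_, ?_⟩
  · refine hf.continuousOn.comp (f := fun u : ℝ => (((1 - u) / 2 : ℝ) : ℂ)) (by fun_prop) ?_
    intro u hu
    change 0 ≤ (1 - u) / 2
    linarith [hu.2]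
  · intro u hu
    rcases eq_or_lt_of_le hu.1 with rfl | h1
    · norm_num [hf.eq_zero]
    rcases eq_or_lt_of_le hu.2 with rfl | h2
    · norm_num [hf.eq_zero]
    have hneg : 0 < 1 - u := sub_pos.2 h2
    have hpos : 0 < 1 + u := by linarith
    have hu : ((1 - u) / 2)⁻¹ - 1 = (1 + u) / (1 - u) := by field_simp; ring
    have hu' : ((1 - -u) / 2)⁻¹ - 1 = ((1 + u) / (1 - u))⁻¹ := by
      rw [sub_neg_eq_add]; field_simp; ring
    beta_reduce
    rw [hu, hu', hsymm _ (div_pos hpos hneg)]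
  · intro x hx
    have hx' : ((1 - (1 - 2 * (1 + x)⁻¹)) / 2)⁻¹ - 1 = x := by field_simp; ring
    beta_reduce
    rw [hx', sub_self, norm_zero, zero_mul]
    exact hδ.le

theorem bump_inv (x : ℝ) : bump x⁻¹ = bump x := by
  rcases le_or_gt x 0 with hx | hx
  · rw [bump, bump, if_pos hx, if_pos (inv_nonpos.2 hx)]
  · rw [bump, bump, if_neg (inv_pos.2 hx).not_ge, if_neg hx.not_ge]
    congr 1
    field_simp
    ring

theorem conj_bump (x : ℝ) : conj (bump x) = bump x := by
  rw [bump]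
  split_ifs
  · exact map_zero _
  · exact conj_ofReal _

theorem cpow_I_mul_eq_exp {x : ℝ} (hx : 0 < x) (t : ℝ) :
    (x : ℂ) ^ (I * t) = exp ((t * Real.log x : ℝ) * I) := by
  rw [cpow_def_of_ne_zero (by exact_mod_cast hx.ne'), ← ofReal_log hx.le]
  push_cast
  ring_nf

theorem cpow_I_mul_inv {x : ℝ} (hx : 0 < x) (t : ℝ) :
    ((x⁻¹ : ℝ) : ℂ) ^ (I * t) = conj ((x : ℂ) ^ (I * t)) := by
  rw [cpow_I_mul_eq_exp (inv_pos.2 hx), cpow_I_mul_eq_exp hx, ← exp_conj, Real.log_inv]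
  simp

theorem modularGroup_mem_realCommutant (hT : skew K ∈ realCommutant T) (t : ℝ) :
    K.modularGroup t ∈ realCommutant T := by
  refine mem_realCommutant_of_mul_mem K.modularFunction_bump_denseRange
    (modularFunction_mem_realCommutant hT bump_vanishesAtEnds fun x _ => ?_) ?_
  · rw [bump_inv, conj_bump]
  rw [K.modularGroup_spec t _ bump_vanishesAtEnds]
  refine modularFunction_mem_realCommutant hT (bump_vanishesAtEnds.cpow_mul t) fun x hx => ?_
  rw [bump_inv, cpow_I_mul_inv hx, map_mul, conj_bump]

theorem hasSymbol_modularGroup_sub (K : StandardSubspace H) (s : ℝ) :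
    HasSymbol K ((1 / 2 : ℝ) • (K.modularGroup s - K.modularGroup (-s)))
      fun x => I * Real.sin (s * Real.log x) := by
  have h := ((HasSymbol.modularGroup K s).sub (HasSymbol.modularGroup K (-s))).const_smul (1 / 2)
  rw [← Complex.coe_smul, ofReal_div, ofReal_one, ofReal_ofNat]
  refine h.congr fun x hx => ?_
  rw [cpow_I_mul_eq_exp hx, cpow_I_mul_eq_exp hx, ofReal_sin, Complex.sin]
  push_cast
  rw [neg_mul (s : ℂ)]
  linear_combination (1 / 2 : ℂ) * (exp (s * Real.log x * I) - exp (-(s * Real.log x) * I)) * I_sq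

/-- As `s → 0`, the function `x ↦ sin (s log x)` becomes injective on larger and larger compact
subsets of `(0, ∞)`, so that `m` is a function of it there. -/
theorem mem_realCommutant_of_modularGroup_mem (hT : ∀ t, K.modularGroup t ∈ realCommutant T)
    {A : H →L[ℂ] H} {m : ℝ → ℂ} (hA : HasSymbol K A m) {C : ℝ} (hm : ContinuousOn m (Ioi 0))
    (hC : ∀ x, 0 < x → ‖m x‖ ≤ C) (hsymm : ∀ x, 0 < x → m x⁻¹ = conj (m x)) :
    A ∈ realCommutant T := by
  refine mem_realCommutant_of_symbol_approx hA fun δ hδ => ?_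
  obtain ⟨s, hsδ, hs⟩ : ∃ s, 2 * C * Real.exp (-(Real.pi / (2 * s))) ≤ δ ∧ 0 < s := by
    have hlim : Tendsto (fun s => 2 * C * Real.exp (-(Real.pi / (2 * s)))) (𝓝[>] 0)
        (𝓝 (2 * C * 0)) := by
      refine (Real.tendsto_exp_neg_atTop_nhds_zero.comp ?_).const_mul _
      simp only [div_mul_eq_div_div, div_eq_mul_inv (Real.pi / 2)]
      exact tendsto_inv_nhdsGT_zero.const_mul_atTop (by positivity)
    exact ((hlim.eventually_le_const (by simpa using hδ)).and self_mem_nhdsWithin).exists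
  refine ⟨_, SMulMemClass.smul_mem (1 / 2 : ℝ) (sub_mem (hT s) (hT (-s))), _,
    fun u => m (Real.exp (Real.arcsin u / s)), hasSymbol_modularGroup_sub K s,
    fun x _ => ⟨Real.neg_one_le_sin _, Real.sin_le_one _⟩, ?_, ?_, ?_⟩
  · exact hm.comp (by fun_prop) fun u _ => Real.exp_pos _
  · intro u _
    beta_reduce
    rw [Real.arcsin_neg, neg_div, Real.exp_neg, hsymm _ (Real.exp_pos _)]
  · intro x hx
    rcases le_or_gt |s * Real.log x| (Real.pi / 2) with hle | hlt
    · have harc : Real.arcsin (Real.sin (s * Real.log x)) = s * Real.log x :=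
        Real.arcsin_sin (neg_le_of_abs_le hle) (le_of_abs_le hle)
      beta_reduce
      rw [harc, mul_div_cancel_left₀ _ hs.ne', Real.exp_log hx, sub_self, norm_zero, zero_mul]
      exact hδ.le
    · have hlog : Real.pi / (2 * s) ≤ |Real.log x| := by
        rw [abs_mul, abs_of_pos hs] at hlt
        rw [div_mul_eq_div_div, div_le_iff₀ hs]
        linarith
      calc _ ≤ (C + C) * Real.exp (-(Real.pi / (2 * s))) := by
            gcongr
            · linarith [norm_nonneg (m 1), hC 1 one_pos]
            · exact (norm_sub_le _ _).trans (add_le_add (hC _ hx) (hC _ (Real.exp_pos _)))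
            · exact (norm_bump_le hx).trans (Real.exp_le_exp.2 (neg_le_neg hlog))
        _ ≤ δ := by linarith

theorem skew_mem_realCommutant (hT : ∀ t, K.modularGroup t ∈ realCommutant T) :
    skew K ∈ realCommutant T := by
  refine mem_realCommutant_of_modularGroup_mem hT (hasSymbol_skew K) (C := 1) ?_ ?_ ?_
  · have hc : ContinuousOn (fun x : ℝ => (1 + x)⁻¹) (Ioi 0) := fun x hx =>
      ((continuous_const.add continuous_id).continuousAt.inv₀
        (by linarith [mem_Ioi.1 hx] : 1 + x ≠ 0)).continuousWithinAt
    exact continuousOn_const.mul (continuous_ofReal.comp_continuousOn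
      (continuousOn_const.sub (continuousOn_const.mul hc)))
  · intro x hx
    rw [norm_mul, norm_I, one_mul, norm_real, Real.norm_eq_abs]
    exact abs_le.2 (mem_Icc_one_sub_two_mul_inv hx)
  · intro x hx
    rw [map_mul, conj_I, conj_ofReal, neg_mul, ← mul_neg, ← ofReal_neg]
    congr 2
    field_simp
    ring

end SkewSymbol

section RealProjection

variable [CompleteSpace H]

/-- The real orthogonal projection onto a standard subspace. -/
abbrev realProj (K : StandardSubspace H) : H →L[ℝ] H :=
  K.toClosedSubmodule.toSubmodule.starProjection

theorem realProj_mem (K : StandardSubspace H) (x : H) : realProj K x ∈ K.toClosedSubmodule :=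
  Submodule.starProjection_apply_mem _ x

theorem realProj_of_mem {K : StandardSubspace H} {x : H} (hx : x ∈ K.toClosedSubmodule) :
    realProj K x = x :=
  Submodule.starProjection_eq_self_iff.2 hx

theorem realProj_realProj (K : StandardSubspace H) (x : H) :
    realProj K (realProj K x) = realProj K x :=
  realProj_of_mem (realProj_mem K x)

theorem inner_sub_realProj {K : StandardSubspace H} (x : H) {y : H}
    (hy : y ∈ K.toClosedSubmodule) : inner ℝ y (x - realProj K x) = 0 :=
  (Submodule.mem_orthogonal _ _).1 (Submodule.sub_starProjection_mem_orthogonal x) y hy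

/-- `x ↦ -i P_K (i x)` is the real orthogonal projection onto `iK`. -/
theorem two_smul_modularResolvent (K : StandardSubspace H) (x : H) :
    (2 : ℂ) • K.modularResolvent x = realProj K x - I • realProj K (I • x) := by
  set p := realProj K x with hp
  set q := realProj K (I • x) with hq
  suffices hB : K.modularResolvent x = (1 / 2 : ℂ) • (p - I • q) by
    rw [hB, smul_smul]
    norm_num
  rw [modularResolvent_eq_iff, modularOperator_graph]
  refine ⟨(1 / 2 : ℂ) • (p + I • q), ?_, ?_⟩
  · have hadd : (1 / 2 : ℂ) • (p - I • q) + (1 / 2 : ℂ) • (p + I • q) = p := by module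
    have hsub : I • ((1 / 2 : ℂ) • (p - I • q) - (1 / 2 : ℂ) • (p + I • q)) = q := by
      have hI : I • ((1 / 2 : ℂ) • (p - I • q) - (1 / 2 : ℂ) • (p + I • q)) = (-(I * I)) • q := by
        module
      rw [hI, I_mul_I, neg_neg, one_smul]
    rw [tomita_graph, mem_tomitaGraph, hadd, hsub]
    exact ⟨realProj_mem K x, realProj_mem K (I • x)⟩
  · rw [mem_tomita_adjoint_graph]
    intro a b hab
    rw [tomita_graph] at hab
    obtain ⟨ξ, hξ, η, hη, hab⟩ := hab
    obtain ⟨rfl, rfl⟩ := Prod.mk.inj hab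
    have hξx := inner_sub_realProj x hξ
    have hηx := inner_sub_realProj (I • x) hη
    rw [← hp] at hξx
    rw [← hq] at hηx
    simp only [inner_real_eq_re_inner, inner_add_left, inner_sub_left, inner_add_right,
      inner_sub_right, inner_smul_left, inner_smul_right] at hξx hηx ⊢
    simp at hξx hηx ⊢
    linarith

theorem skew_apply (K : StandardSubspace H) (x : H) :
    skew K x = I • x - I • realProj K x - realProj K (I • x) := by
  change I • (x - (2 : ℂ) • K.modularResolvent x) = _
  rw [two_smul_modularResolvent, smul_sub, smul_sub, smul_smul, I_mul_I]
  module

theorem skew_mem_realCommutant_realProj (K : StandardSubspace H) :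
    skew K ∈ realCommutant (realProj K) := by
  refine mem_realCommutant.2 fun x => ?_
  simp only [skew_apply, map_sub, realProj_realProj]
  abel

theorem modularGroup_mem_realCommutant_realProj (K : StandardSubspace H) (t : ℝ) :
    K.modularGroup t ∈ realCommutant (realProj K) :=
  modularGroup_mem_realCommutant (skew_mem_realCommutant_realProj K) t

theorem eq_zero_of_inner_eq_zero (K : StandardSubspace H) {ζ : H}
    (hre : ∀ ξ ∈ K.toClosedSubmodule, inner ℝ ξ ζ = 0)
    (him : ∀ ξ ∈ K.toClosedSubmodule, inner ℝ (I • ξ) ζ = 0) : ζ = 0 := by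
  have hζ : ζ ∈ K.symplComp.toClosedSubmodule := mem_symplComp_iff.2 fun ξ hξ => by
    simpa [inner_real_eq_re_inner, inner_smul_left] using him ξ hξ
  have hIζ : ζ ∈ K.symplComp.toClosedSubmodule.mulI := by
    rw [mem_mapEquiv_iff, scalarSMulCLE_symm_apply]
    refine mem_symplComp_iff.2 fun ξ hξ => ?_
    simpa [inner_real_eq_re_inner, Units.smul_def, inner_smul_right] using hre ξ hξ
  have hmem : ζ ∈ K.symplComp.toClosedSubmodule ⊓ K.symplComp.toClosedSubmodule.mulI := ⟨hζ, hIζ⟩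
  rw [K.symplComp.IsSeparating] at hmem
  simpa using hmem

theorem eq_of_le_of_modularGroup_mem_realCommutant {K L : StandardSubspace H}
    (hle : L.toClosedSubmodule ≤ K.toClosedSubmodule)
    (hL : ∀ t, K.modularGroup t ∈ realCommutant (realProj L)) : L = K := by
  have hskew : ∀ x, realProj L (skew K x) = skew K (realProj L x) := skew_mem_realCommutant hL
  refine toClosedSubmodule_inj.1 (le_antisymm hle fun η hη => ?_)
  suffices hη' : η - realProj L η = 0 from sub_eq_zero.1 hη' ▸ realProj_mem L η
  have hζK : η - realProj L η ∈ K.toClosedSubmodule :=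
    K.toClosedSubmodule.toSubmodule.sub_mem hη (hle (realProj_mem L η))
  have hre : ∀ ξ ∈ L.toClosedSubmodule, inner ℝ ξ (η - realProj L η) = 0 :=
    fun ξ => inner_sub_realProj η
  -- On `L ⊆ K` the operator `skew K` is `-P_K i`, and it maps `L` into `L`.
  refine eq_zero_of_inner_eq_zero L hre fun ξ hξ => ?_
  have hskewξ : skew K ξ ∈ L.toClosedSubmodule := by
    rw [← realProj_of_mem hξ, ← hskew]
    exact realProj_mem L _
  have hproj : inner ℝ (realProj K (I • ξ)) (η - realProj L η) = 0 := by
    simpa [skew_apply, realProj_of_mem (hle hξ)] using hre _ hskewξ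
  have hsub := inner_sub_realProj (I • ξ) hζK
  rwa [real_inner_comm, inner_sub_left, hproj, sub_zero] at hsub

end RealProjection

section SymplecticComplement

variable [CompleteSpace H]

theorem realProj_symplComp (K : StandardSubspace H) (x : H) :
    realProj K.symplComp x = x + I • realProj K (I • x) := by
  refine Submodule.eq_starProjection_of_mem_orthogonal (mem_symplComp_iff.2 fun y hy => ?_)
    ((Submodule.mem_orthogonal _ _).2 fun y hy => ?_)
  · have h := inner_sub_realProj (I • x) hy
    simp only [inner_real_eq_re_inner, inner_sub_right, inner_add_right, inner_smul_right] at h ⊢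
    simp only [mul_re, I_re, I_im, add_im, mul_im] at h ⊢
    linarith
  · have h := mem_symplComp_iff.1 hy _ (realProj_mem K (I • x))
    have hsymm : (⟪y, realProj K (I • x)⟫).im = -(⟪realProj K (I • x), y⟫).im :=
      inner_im_symm (𝕜 := ℂ) _ _
    rw [sub_add_cancel_left, inner_neg_right, neg_eq_zero, inner_real_eq_re_inner,
      inner_smul_right]
    simp [hsymm, h]

theorem modularResolvent_symplComp (K : StandardSubspace H) :
    K.symplComp.modularResolvent = 1 - K.modularResolvent := by
  ext x
  refine smul_right_injective H (two_ne_zero (α := ℂ)) ?_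
  change (2 : ℂ) • K.symplComp.modularResolvent x = (2 : ℂ) • (x - K.modularResolvent x)
  have hI (y : H) : I • I • y = -y := by rw [smul_smul, I_mul_I, neg_one_smul]
  rw [smul_sub, two_smul_modularResolvent, two_smul_modularResolvent, realProj_symplComp,
    realProj_symplComp, hI, map_neg, smul_neg, smul_add, hI, smul_neg, hI]
  module

theorem modularFunction_symplComp (K : StandardSubspace H) {f : ℝ → ℂ} (hf : VanishesAtEnds f) :
    K.symplComp.modularFunction f = K.modularFunction fun x => f x⁻¹ := by
  have hB := isStarNormal_modularResolvent K
  have hsub : 1 - K.modularResolvent = cfc (fun z : ℂ => 1 - z) K.modularResolvent := by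
    rw [cfc_sub _ _ _ (by fun_prop) (by fun_prop), cfc_id' ℂ K.modularResolvent,
      cfc_const_one ℂ K.modularResolvent]
  have hc : ContinuousOn (fun z : ℂ => f (z.re⁻¹ - 1))
      ((fun z : ℂ => 1 - z) '' spectrum ℂ K.modularResolvent) := by
    refine hf.continuousOn.mono (image_subset_iff.2 fun z hz => ?_)
    simpa using (K.modularResolvent_spectrum hz).2.2
  rw [modularFunction, modularFunction, modularResolvent_symplComp, hsub,
    ← cfc_comp _ _ _ (hf := by fun_prop) (hg := hc)]
  refine cfc_congr fun z hz => ?_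
  obtain ⟨-, h0, h1⟩ := K.modularResolvent_spectrum hz
  simp only [Function.comp_apply, sub_re, one_re]
  rcases eq_or_lt_of_le h0 with h0 | h0
  · rw [← h0, hf.eq_zero _ (by norm_num), hf.eq_zero _ (by norm_num)]
  rcases eq_or_lt_of_le h1 with h1 | h1
  · rw [h1, hf.eq_zero _ (by norm_num), hf.eq_zero _ (by norm_num)]
  have hne : 1 - z.re ≠ 0 := by linarith
  have hinv : z.re⁻¹ - 1 = (1 - z.re) / z.re := by field_simp
  congr 1
  rw [hinv, inv_div]
  field_simp
  ring

theorem modularGroup_symplComp (K : StandardSubspace H) (t : ℝ) :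
    K.symplComp.modularGroup t = K.modularGroup (-t) := by
  refine eq_of_mul_eq_of_denseRange K.symplComp.modularFunction_bump_denseRange ?_
  rw [K.symplComp.modularGroup_spec t _ bump_vanishesAtEnds,
    modularFunction_symplComp K bump_vanishesAtEnds,
    modularFunction_symplComp K (bump_vanishesAtEnds.cpow_mul t)]
  simp only [bump_inv]
  rw [K.modularGroup_spec (-t) _ bump_vanishesAtEnds]
  congr 1
  funext x
  rcases le_or_gt x 0 with hx | hx
  · simp [bump, hx]
  · rw [cpow_I_mul_eq_exp (inv_pos.2 hx), cpow_I_mul_eq_exp hx, Real.log_inv, mul_neg, neg_mul]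

theorem modularGroup_add (K : StandardSubspace H) (s t : ℝ) :
    K.modularGroup (s + t) = K.modularGroup s * K.modularGroup t := by
  refine (HasSymbol.modularGroup K _).unique
    (((HasSymbol.modularGroup K s).mul (HasSymbol.modularGroup K t)).congr fun x hx => ?_)
  rw [← cpow_add _ _ (by exact_mod_cast hx.ne'), ← mul_add, ofReal_add]

theorem modularGroup_zero (K : StandardSubspace H) : K.modularGroup 0 = 1 :=
  (HasSymbol.modularGroup K 0).unique
    (by simpa using HasSymbol.const K 1)

end SymplecticComplement

section UnitaryAction

variable [CompleteSpace H] {u : unitary (H →L[ℂ] H)}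

/-- A unitary operator as a real linear homeomorphism, which moves real subspaces around. -/
def realEquiv (u : unitary (H →L[ℂ] H)) : H ≃L[ℝ] H :=
  (Unitary.linearIsometryEquiv u).toContinuousLinearEquiv.restrictScalars ℝ

theorem mulI_mapEquiv_realEquiv (u : unitary (H →L[ℂ] H)) (S : ClosedSubmodule ℝ H) :
    (S.mapEquiv (realEquiv u)).mulI = S.mulI.mapEquiv (realEquiv u) := by
  refine SetLike.ext fun x => ?_
  have hcomm : (realEquiv u).symm ((scalarSMulCLE H UnitI).symm x) =
      (scalarSMulCLE H UnitI).symm ((realEquiv u).symm x) :=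
    map_smul (star u : unitary (H →L[ℂ] H)).1 _ x
  rw [mem_mapEquiv_iff, mem_mapEquiv_iff, mem_mapEquiv_iff, mem_mapEquiv_iff, hcomm]

/-- The action `u • K = u K` of the unitary group on standard subspaces. -/
instance : MulAction (unitary (H →L[ℂ] H)) (StandardSubspace H) where
  smul u K :=
    ⟨K.toClosedSubmodule.mapEquiv (realEquiv u),
      by rw [mulI_mapEquiv_realEquiv, ← mapEquiv_inf_eq, K.IsSeparating, mapEquiv_bot_eq_bot],
      by rw [mulI_mapEquiv_realEquiv, ← mapEquiv_sup_eq, K.IsCyclic, mapEquiv_top_eq_top]⟩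
  one_smul K := toClosedSubmodule_inj.1 <| SetLike.ext fun x => by
    change x ∈ K.toClosedSubmodule.mapEquiv (realEquiv 1) ↔ _
    rw [mem_mapEquiv_iff, realEquiv, map_one]
    rfl
  mul_smul u v K := toClosedSubmodule_inj.1 <| SetLike.ext fun x => by
    change x ∈ K.toClosedSubmodule.mapEquiv (realEquiv (u * v)) ↔
      x ∈ (K.toClosedSubmodule.mapEquiv (realEquiv v)).mapEquiv (realEquiv u)
    rw [mem_mapEquiv_iff, mem_mapEquiv_iff, mem_mapEquiv_iff, realEquiv, map_mul]
    rfl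

theorem coe_smul (u : unitary (H →L[ℂ] H)) (K : StandardSubspace H) :
    ((u • K).toClosedSubmodule : Set H) = (u : H →L[ℂ] H) '' K.toClosedSubmodule := rfl

theorem apply_mem_smul_iff {K : StandardSubspace H} {x : H} :
    (u : H →L[ℂ] H) x ∈ (u • K).toClosedSubmodule ↔ x ∈ K.toClosedSubmodule :=
  mem_mapEquiv_iff' (realEquiv u) K.toClosedSubmodule x

theorem realProj_smul (u : unitary (H →L[ℂ] H)) (K : StandardSubspace H) (x : H) :
    realProj (u • K) ((u : H →L[ℂ] H) x) = (u : H →L[ℂ] H) (realProj K x) := by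
  refine Submodule.eq_starProjection_of_mem_orthogonal (apply_mem_smul_iff.2 (realProj_mem K x))
    ((Submodule.mem_orthogonal _ _).2 ?_)
  rintro _ ⟨y, hy, rfl⟩
  change inner ℝ ((u : H →L[ℂ] H) y) _ = 0
  rw [← map_sub, inner_real_eq_re_inner, Unitary.inner_map_map]
  exact inner_sub_realProj x hy

theorem symplComp_smul (u : unitary (H →L[ℂ] H)) (K : StandardSubspace H) :
    (u • K).symplComp = u • K.symplComp := by
  refine toClosedSubmodule_inj.1 (SetLike.ext ((realEquiv u).surjective.forall.2 fun x => ?_))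
  change (u : H →L[ℂ] H) x ∈ _ ↔ (u : H →L[ℂ] H) x ∈ _
  rw [apply_mem_smul_iff]
  change (u : H →L[ℂ] H) x ∈ (u • K).toClosedSubmodule.symplComp ↔ x ∈ K.toClosedSubmodule.symplComp
  rw [mem_symplComp_iff, mem_symplComp_iff]
  refine (realEquiv u).surjective.forall.trans (forall_congr' fun y => ?_)
  change (u : H →L[ℂ] H) y ∈ _ → (⟪(u : H →L[ℂ] H) y, _⟫).im = 0 ↔ _
  rw [apply_mem_smul_iff, Unitary.inner_map_map]

theorem modularResolvent_smul_mul (u : unitary (H →L[ℂ] H)) (K : StandardSubspace H) :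
    (u • K).modularResolvent * u = u * K.modularResolvent := by
  ext x
  refine smul_right_injective H (two_ne_zero (α := ℂ)) ?_
  simp only [mul_apply_eq_comp]
  rw [two_smul_modularResolvent, ← map_smul (u : H →L[ℂ] H) I, realProj_smul, realProj_smul,
    ← map_smul (u : H →L[ℂ] H) 2, two_smul_modularResolvent, map_sub, map_smul (u : H →L[ℂ] H)]

theorem modularFunction_smul_mul (u : unitary (H →L[ℂ] H)) (K : StandardSubspace H) {f : ℝ → ℂ}
    (hf : VanishesAtEnds f) :
    (u • K).modularFunction f * u = u * K.modularFunction f := by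
  have hu : (u : H →L[ℂ] H) * (star u : H →L[ℂ] H) = 1 := Unitary.mul_star_self_of_mem u.2
  have hu' : (star u : H →L[ℂ] H) * u = 1 := Unitary.star_mul_self_of_mem u.2
  have hB : Unitary.conjStarAlgAut ℂ (H →L[ℂ] H) u K.modularResolvent =
      (u • K).modularResolvent := by
    rw [Unitary.conjStarAlgAut_apply, ← modularResolvent_smul_mul, mul_assoc, hu, mul_one]
  have hφ : Continuous (Unitary.conjStarAlgAut ℂ (H →L[ℂ] H) u) := by
    change Continuous fun A => _
    simp only [Unitary.conjStarAlgAut_apply]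
    fun_prop
  have hmap := StarAlgHomClass.map_cfc (S := ℂ) (Unitary.conjStarAlgAut ℂ (H →L[ℂ] H) u)
    (fun z : ℂ => f (z.re⁻¹ - 1)) K.modularResolvent
    (hf := continuousOn_spectrum_modularResolvent K hf) (hφ := hφ)
    (ha := isStarNormal_modularResolvent K) (hφa := hB ▸ isStarNormal_modularResolvent (u • K))
  rw [hB] at hmap
  change cfc _ _ * _ = _
  rw [← hmap, Unitary.conjStarAlgAut_apply, mul_assoc, hu', mul_one]
  rfl

theorem modularGroup_smul_mul (u : unitary (H →L[ℂ] H)) (K : StandardSubspace H) (t : ℝ) :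
    (u • K).modularGroup t * u = u * K.modularGroup t := by
  refine eq_of_mul_eq_of_denseRange K.modularFunction_bump_denseRange ?_
  rw [mul_assoc, mul_assoc, ← modularFunction_smul_mul u K bump_vanishesAtEnds,
    K.modularGroup_spec t _ bump_vanishesAtEnds,
    ← modularFunction_smul_mul u K (bump_vanishesAtEnds.cpow_mul t), ← mul_assoc,
    (u • K).modularGroup_spec t _ bump_vanishesAtEnds]

end UnitaryAction

section ReflectedSubspace

variable [CompleteSpace H] {K : StandardSubspace H} {r : unitary (H →L[ℂ] H)}

theorem modularGroup_smul_of_commute {u : unitary (H →L[ℂ] H)} {t : ℝ} (hru : r * u = u⁻¹ * r)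
    (hZ : Commute (K.modularGroup t * u) (r : H →L[ℂ] H)) :
    (r • K).modularGroup t = K.modularGroup t * ↑(u * u) := by
  have hcancel : (r • K).modularGroup t * ↑(u⁻¹ * r) = K.modularGroup t * ↑(u * r) := by
    rw [← hru, Submonoid.coe_mul, Submonoid.coe_mul, ← mul_assoc, modularGroup_smul_mul, mul_assoc,
      ← hZ.eq, mul_assoc]
  calc (r • K).modularGroup t
    _ = (r • K).modularGroup t * ↑(u⁻¹ * r * (r⁻¹ * u)) := by simp
    _ = K.modularGroup t * ↑(u * r * (r⁻¹ * u)) := by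
      rw [Submonoid.coe_mul, ← mul_assoc, hcancel, mul_assoc, ← Submonoid.coe_mul]
    _ = K.modularGroup t * ↑(u * u) := by group

variable {u : ℝ → unitary (H →L[ℂ] H)}

theorem coe_mem_realCommutant_realProj {v : unitary (H →L[ℂ] H)} (hv : v • K = K) :
    (v : H →L[ℂ] H) ∈ realCommutant (realProj K) :=
  fun x => by simpa only [hv] using realProj_smul v K x

theorem smul_eq_symplComp (hle : (r • K).toClosedSubmodule ≤ K.symplComp.toClosedSubmodule)
    (hK : ∀ t, u t • K = K) (hru : ∀ t, r * u t = (u t)⁻¹ * r)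
    (hZ : ∀ t, Commute (K.modularGroup t * u t) (r : H →L[ℂ] H)) :
    r • K = K.symplComp := by
  refine eq_of_le_of_modularGroup_mem_realCommutant hle fun t => ?_
  have hfix (s : ℝ) : u s • r • K = r • K := by
    conv_lhs => rw [← hK s]
    rw [smul_smul, smul_smul, mul_assoc, hru, mul_inv_cancel_left]
  have hfix_sq : (u (-t) * u (-t))⁻¹ • r • K = r • K := by
    rw [inv_smul_eq_iff, mul_smul, hfix, hfix]
  have hgroup : K.symplComp.modularGroup t =
      (r • K).modularGroup (-t) * ↑(u (-t) * u (-t))⁻¹ := by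
    rw [modularGroup_symplComp, modularGroup_smul_of_commute (hru _) (hZ _), mul_assoc,
      ← Submonoid.coe_mul, mul_inv_cancel, OneMemClass.coe_one, mul_one]
  rw [hgroup]
  exact mul_mem (modularGroup_mem_realCommutant_realProj _ _)
    (coe_mem_realCommutant_realProj hfix_sq)

theorem coe_mul_self_eq_modularGroup (hrK : r • K = K.symplComp) {v : unitary (H →L[ℂ] H)} {t : ℝ}
    (hru : r * v = v⁻¹ * r) (hZ : Commute (K.modularGroup t * v) (r : H →L[ℂ] H)) :
    (↑(v * v) : H →L[ℂ] H) = K.modularGroup (-(2 * t)) := by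
  calc (↑(v * v) : H →L[ℂ] H)
    _ = K.modularGroup (-t) * (K.modularGroup t * ↑(v * v)) := by
      rw [← mul_assoc, ← modularGroup_add, neg_add_cancel, modularGroup_zero, one_mul]
    _ = K.modularGroup (-(2 * t)) := by
      rw [← modularGroup_smul_of_commute hru hZ, hrK, modularGroup_symplComp, ← modularGroup_add]
      ring_nf

end ReflectedSubspace

end TomitaTakesaki

end ModularTheory

noncomputable section Minkowski

open Matrix
open scoped Pointwise Topology

section LorentzMatrices

theorem lorentzMatrix_injective : Function.Injective lorentzMatrix :=
  fun _ _ h => Subtype.ext (Subtype.ext (Units.ext h))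

theorem lorentzMatrix_transpose_mul (Λ : properLorentz) :
    (lorentzMatrix Λ)ᵀ * minkowskiMetric * lorentzMatrix Λ = minkowskiMetric :=
  (Λ : lorentzGroup).2

theorem minkowskiMetric_mul_self : minkowskiMetric * minkowskiMetric = 1 := by
  rw [minkowskiMetric, diagonal_mul_diagonal, ← diagonal_one]
  congr 1
  ext i
  fin_cases i <;> simp

theorem lorentzMatrix_inv (Λ : properLorentz) :
    lorentzMatrix Λ⁻¹ = minkowskiMetric * (lorentzMatrix Λ)ᵀ * minkowskiMetric := by
  refine (left_inv_eq_right_inv (a := lorentzMatrix Λ) ?_ ?_).symm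
  · rw [Matrix.mul_assoc, Matrix.mul_assoc, ← Matrix.mul_assoc _ minkowskiMetric,
      lorentzMatrix_transpose_mul, minkowskiMetric_mul_self]
  · rw [← lorentzMatrix_mul, mul_inv_cancel, lorentzMatrix_one]

theorem lorentzMatrix_inv_apply_eq_zero_iff (Λ : properLorentz) (i j : Fin 4) :
    lorentzMatrix Λ⁻¹ i j = 0 ↔ lorentzMatrix Λ j i = 0 := by
  have hne (k : Fin 4) : (![1, -1, -1, -1] : Fin 4 → ℝ) k ≠ 0 := by fin_cases k <;> simp
  rw [lorentzMatrix_inv, minkowskiMetric, mul_diagonal, diagonal_mul, transpose_apply]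
  simp only [mul_eq_zero, hne, false_or, or_false]

theorem transpose_mul_minkowskiMetric_mul_apply (M : Matrix (Fin 4) (Fin 4) ℝ) (i j : Fin 4) :
    (Mᵀ * minkowskiMetric * M) i j =
      M 0 i * M 0 j - M 1 i * M 1 j - M 2 i * M 2 j - M 3 i * M 3 j := by
  simp [mul_apply, Fin.sum_univ_four, minkowskiMetric, diagonal_apply]
  ring

theorem lorentzGroup_apply_zero_zero_ne_zero (Λ : lorentzGroup) :
    ((Λ : GL (Fin 4) ℝ) : Matrix (Fin 4) (Fin 4) ℝ) 0 0 ≠ 0 := by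
  intro h0
  have h := transpose_mul_minkowskiMetric_mul_apply (Λ : GL (Fin 4) ℝ) 0 0
  rw [Λ.2, h0, minkowskiMetric, diagonal_apply_eq, cons_val_zero] at h
  nlinarith

theorem lorentzMatrix_zero_zero_pos (Λ : properLorentz) : 0 < lorentzMatrix Λ 0 0 := by
  let φ (M : lorentzGroup) : ℝ := ((M : GL (Fin 4) ℝ) : Matrix (Fin 4) (Fin 4) ℝ) 0 0
  have hφ : Continuous φ :=
    (Units.continuous_val.comp continuous_subtype_val).matrix_elem 0 0
  by_contra! hle
  have hmem : (0 : ℝ) ∈ Set.Icc (φ Λ) (φ 1) := ⟨hle, zero_le_one⟩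
  obtain ⟨M, -, hM⟩ :=
    (isPreconnected_connectedComponent (x := (1 : lorentzGroup))).intermediate_value
      Λ.2 mem_connectedComponent hφ.continuousOn hmem
  exact lorentzGroup_apply_zero_zero_ne_zero M hM

end LorentzMatrices

section Boosts

theorem lorentz_mul (A B : properLorentz) : lorentz (A * B) = lorentz A * lorentz B :=
  map_mul SemidirectProduct.inr A B

theorem lorentz_inv (A : properLorentz) : lorentz A⁻¹ = (lorentz A)⁻¹ :=
  map_inv SemidirectProduct.inr A

theorem boostMatrix_add (s t : ℝ) : boostMatrix (s + t) = boostMatrix s * boostMatrix t := by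
  ext i j
  fin_cases i <;> fin_cases j <;>
    simp [boostMatrix, mul_apply, Fin.sum_univ_four, Real.cosh_add, Real.sinh_add] <;> ring

theorem boost_add (s t : ℝ) : boost (s + t) = boost s * boost t :=
  lorentzMatrix_injective (boostMatrix_add s t)

theorem boost_neg (t : ℝ) : boost (-t) = (boost t)⁻¹ :=
  lorentzMatrix_injective rfl

theorem spaceRotation_pi_mul_boost (t : ℝ) :
    spaceRotation Real.pi * boost t = (boost t)⁻¹ * spaceRotation Real.pi := by
  rw [← boost_neg]
  apply lorentzMatrix_injective
  change rotationMatrix Real.pi * boostMatrix t = boostMatrix (-t) * rotationMatrix Real.pi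
  ext i j
  fin_cases i <;> fin_cases j <;>
    simp [boostMatrix, rotationMatrix, mul_apply, Fin.sum_univ_four]

theorem mem_rightWedge_iff {x : Spacetime} :
    x ∈ rightWedge ↔ 0 < x 1 + x 0 ∧ 0 < x 1 - x 0 := by
  change |x 0| < x 1 ↔ _
  rw [abs_lt]
  constructor <;> rintro ⟨h1, h2⟩ <;> constructor <;> linarith

theorem boost_smul_rightWedge_subset (t : ℝ) : lorentz (boost t) • rightWedge ⊆ rightWedge := by
  rintro _ ⟨x, hx, rfl⟩
  have h0 : (lorentz (boost t) • x) 0 = Real.cosh t * x 0 + Real.sinh t * x 1 := by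
    change (boostMatrix t *ᵥ x + 0) 0 = _
    simp [boostMatrix, dotProduct, Fin.sum_univ_four]
  have h1 : (lorentz (boost t) • x) 1 = Real.sinh t * x 0 + Real.cosh t * x 1 := by
    change (boostMatrix t *ᵥ x + 0) 1 = _
    simp [boostMatrix, dotProduct, Fin.sum_univ_four]
  obtain ⟨hplus, hminus⟩ := mem_rightWedge_iff.1 hx
  refine mem_rightWedge_iff.2 ⟨?_, ?_⟩
  · calc 0 < Real.exp t * (x 1 + x 0) := by positivity
      _ = (lorentz (boost t) • x) 1 + (lorentz (boost t) • x) 0 := by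
        rw [h0, h1, ← Real.cosh_add_sinh]; ring
  · calc 0 < Real.exp (-t) * (x 1 - x 0) := by positivity
      _ = (lorentz (boost t) • x) 1 - (lorentz (boost t) • x) 0 := by
        rw [h0, h1, ← Real.cosh_sub_sinh]; ring

theorem boost_smul_rightWedge (t : ℝ) : lorentz (boost t) • rightWedge = rightWedge := by
  refine (boost_smul_rightWedge_subset t).antisymm ?_
  rw [Set.subset_smul_set_iff, ← lorentz_inv, ← boost_neg]
  exact boost_smul_rightWedge_subset (-t)

end Boosts

section Stabilizer

theorem add_mul_pos_of_mem_rightWedge {x : Spacetime} (hx : x ∈ rightWedge) {σ : ℝ}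
    (hσ : |σ| ≤ 1) : 0 < x 1 + σ * x 0 := by
  have h : |σ * x 0| ≤ |x 0| := by
    rw [abs_mul]
    exact mul_le_of_le_one_left (abs_nonneg _) hσ
  linarith [neg_abs_le (σ * x 0), show |x 0| < x 1 from hx]

theorem smul_one_add_mul_smul_zero (g : Poincare) (x : Spacetime) (σ : ℝ) :
    (g • x) 1 + σ * (g • x) 0 =
      (lorentzMatrix g.right 1 + σ • lorentzMatrix g.right 0) ⬝ᵥ x +
        (g.left.toAdd 1 + σ * g.left.toAdd 0) := by
  rw [poincare_smul_def, add_dotProduct, smul_dotProduct, smul_eq_mul]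
  change _ ⬝ᵥ _ + _ + σ * (_ ⬝ᵥ _ + _) = _
  ring

theorem nonneg_of_forall_pos_mul_add_pos {m c : ℝ} (h : ∀ s > 0, 0 < s * m + c) : 0 ≤ c := by
  have hlim : Filter.Tendsto (fun s : ℝ => s * m + c) (𝓝[>] 0) (𝓝 c) :=
    (Continuous.tendsto' (by fun_prop) 0 c (by simp)).mono_left nhdsWithin_le_nhds
  exact ge_of_tendsto hlim (eventually_mem_nhdsWithin.mono fun s hs => (h s hs).le)

theorem smul_single_one_mem_rightWedge {s : ℝ} (hs : 0 < s) :
    s • (Pi.single 1 1 : Spacetime) ∈ rightWedge := by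
  simpa [rightWedge] using hs

theorem const_nonneg_of_affine_pos {p : Spacetime} {c : ℝ}
    (h : ∀ x ∈ rightWedge, 0 < p ⬝ᵥ x + c) : 0 ≤ c := by
  refine nonneg_of_forall_pos_mul_add_pos (m := p 1) fun s hs => ?_
  have hpos := h _ (smul_single_one_mem_rightWedge hs)
  rwa [dotProduct_smul, dotProduct_single_one, smul_eq_mul] at hpos

theorem dotProduct_nonneg_of_affine_pos {p : Spacetime} {c : ℝ}
    (h : ∀ x ∈ rightWedge, 0 < p ⬝ᵥ x + c) {x : Spacetime} (hx : |x 0| ≤ x 1) : 0 ≤ p ⬝ᵥ x := by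
  refine nonneg_of_forall_pos_mul_add_pos (m := p 1 + c) fun s hs => ?_
  have hmem : s⁻¹ • x + Pi.single 1 1 ∈ rightWedge := by
    change |s⁻¹ * x 0 + (Pi.single 1 1 : Spacetime) 0| < s⁻¹ * x 1 + (Pi.single 1 1 : Spacetime) 1
    rw [Pi.single_eq_same, Pi.single_eq_of_ne (by decide), add_zero, abs_mul,
      abs_of_pos (inv_pos.2 hs)]
    have := mul_le_mul_of_nonneg_left hx (inv_pos.2 hs).le
    linarith
  have hpos := mul_pos hs (h _ hmem)
  rw [dotProduct_add, dotProduct_smul, dotProduct_single_one, smul_eq_mul, add_assoc, mul_add,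
    mul_inv_cancel_left₀ hs.ne'] at hpos
  rwa [add_comm]

variable {g : Poincare}

theorem row_affine_pos (hg : g • rightWedge ⊆ rightWedge) {σ : ℝ} (hσ : |σ| ≤ 1) :
    ∀ x ∈ rightWedge, 0 < (lorentzMatrix g.right 1 + σ • lorentzMatrix g.right 0) ⬝ᵥ x +
      (g.left.toAdd 1 + σ * g.left.toAdd 0) := by
  intro x hx
  rw [← smul_one_add_mul_smul_zero]
  exact add_mul_pos_of_mem_rightWedge (hg (Set.smul_mem_smul_set hx)) hσ

theorem row_dotProduct_nonneg (hg : g • rightWedge ⊆ rightWedge) {σ : ℝ} (hσ : |σ| ≤ 1)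
    {x : Spacetime} (hx : |x 0| ≤ x 1) :
    0 ≤ (lorentzMatrix g.right 1 + σ • lorentzMatrix g.right 0) ⬝ᵥ x :=
  dotProduct_nonneg_of_affine_pos (row_affine_pos hg hσ) hx

theorem lorentzMatrix_one_one_nonneg (hg : g • rightWedge ⊆ rightWedge) :
    0 ≤ lorentzMatrix g.right 1 1 := by
  simpa using row_dotProduct_nonneg hg (σ := 0) (by simp) (x := Pi.single 1 1) (by simp)

theorem lorentzMatrix_apply_eq_zero (hg : g • rightWedge ⊆ rightWedge) {j : Fin 4}
    (h0 : j ≠ 0) (h1 : j ≠ 1) :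
    lorentzMatrix g.right 0 j = 0 ∧ lorentzMatrix g.right 1 j = 0 := by
  have hrow {σ : ℝ} (hσ : |σ| ≤ 1) :
      lorentzMatrix g.right 1 j + σ * lorentzMatrix g.right 0 j = 0 := by
    have hpos := row_dotProduct_nonneg hg hσ (x := Pi.single j 1) (by simp [h0.symm, h1.symm])
    have hneg := row_dotProduct_nonneg hg hσ (x := -Pi.single j 1) (by simp [h0.symm, h1.symm])
    rw [dotProduct_neg] at hneg
    simpa using le_antisymm (neg_nonneg.1 hneg) hpos
  have hrow₀ := hrow (σ := 0) (by simp)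
  have hrow₁ := hrow (σ := 1) (by simp)
  constructor <;> linarith

theorem diag_eq_and_offDiag_eq_of_hyperbolic {a b c d : ℝ} (ha : 0 < a) (hd : 0 ≤ d)
    (hac : a * a - c * c = 1) (hbd : b * b - d * d = -1) (hcross : a * b - c * d = 0) :
    d = a ∧ b = c := by
  have hbc : b ^ 2 = c ^ 2 := by
    linear_combination (a * b + c * d) * hcross - b ^ 2 * hac - c ^ 2 * hbd
  have hda : d = a :=
    (sq_eq_sq₀ hd ha.le).1 (by linear_combination -hbd - hac + hbc)
  refine ⟨hda, mul_left_cancel₀ ha.ne' ?_⟩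
  linear_combination hcross + c * hda

theorem translation_eq_zero (hg : g • rightWedge = rightWedge) :
    g.left.toAdd 0 = 0 ∧ g.left.toAdd 1 = 0 := by
  -- The infimum of `x₁ + σ x₀` over the wedge is `0`, and `g` shifts it by `a₁ + σ a₀`.
  have hshift {σ : ℝ} (hσ : |σ| ≤ 1) : g.left.toAdd 1 + σ * g.left.toAdd 0 = 0 := by
    refine le_antisymm (le_of_forall_pos_le_add fun s hs => ?_)
      (const_nonneg_of_affine_pos (row_affine_pos hg.le hσ))
    obtain ⟨x, hx, hxs⟩ := hg.ge (smul_single_one_mem_rightWedge hs)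
    have hgx : g • x = s • Pi.single 1 1 := hxs
    have hs_eq : (g • x) 1 + σ * (g • x) 0 = s := by simp [hgx]
    rw [smul_one_add_mul_smul_zero] at hs_eq
    linarith [row_dotProduct_nonneg hg.le hσ (le_of_lt hx)]
  have hshift₀ := hshift (σ := 0) (by simp)
  have hshift₁ := hshift (σ := 1) (by simp)
  constructor <;> linarith

theorem lorentzMatrix_eq_block (hg : g • rightWedge = rightWedge) :
    ∃ c s p q u v : ℝ, lorentzMatrix g.right =
      !![c, s, 0, 0; s, c, 0, 0; 0, 0, p, q; 0, 0, u, v] := by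
  have hg_inv : g⁻¹ • rightWedge ⊆ rightWedge := (inv_smul_eq_iff.2 hg.symm).le
  set M := lorentzMatrix g.right
  have hright (j : Fin 4) (h0 : j ≠ 0) (h1 : j ≠ 1) : M 0 j = 0 ∧ M 1 j = 0 :=
    lorentzMatrix_apply_eq_zero hg.le h0 h1
  have hleft (j : Fin 4) (h0 : j ≠ 0) (h1 : j ≠ 1) : M j 0 = 0 ∧ M j 1 = 0 := by
    simpa only [SemidirectProduct.inv_right, lorentzMatrix_inv_apply_eq_zero_iff] using
      lorentzMatrix_apply_eq_zero hg_inv h0 h1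
  obtain ⟨h02, h12⟩ := hright 2 (by decide) (by decide)
  obtain ⟨h03, h13⟩ := hright 3 (by decide) (by decide)
  obtain ⟨h20, h21⟩ := hleft 2 (by decide) (by decide)
  obtain ⟨h30, h31⟩ := hleft 3 (by decide) (by decide)
  obtain ⟨hdiag, hoff⟩ : M 1 1 = M 0 0 ∧ M 0 1 = M 1 0 := by
    have hM (i j : Fin 4) : M 0 i * M 0 j - M 1 i * M 1 j - M 2 i * M 2 j - M 3 i * M 3 j =
        minkowskiMetric i j := by
      rw [← transpose_mul_minkowskiMetric_mul_apply, lorentzMatrix_transpose_mul]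
    refine diag_eq_and_offDiag_eq_of_hyperbolic (lorentzMatrix_zero_zero_pos g.right)
      (lorentzMatrix_one_one_nonneg hg.le) ?_ ?_ ?_
    · simpa [minkowskiMetric, h20, h30] using hM 0 0
    · simpa [minkowskiMetric, h21, h31] using hM 1 1
    · simpa [minkowskiMetric, h20, h30, h21, h31] using hM 0 1
  refine ⟨M 0 0, M 1 0, M 2 2, M 2 3, M 3 2, M 3 3, ?_⟩
  ext i j
  fin_cases i <;> fin_cases j <;>
    simp [h02, h03, h12, h13, h20, h21, h30, h31, hdiag, hoff]

theorem commute_boost_of_smul_rightWedge (hg : g • rightWedge = rightWedge) (t : ℝ) :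
    Commute g (lorentz (boost t)) := by
  refine SemidirectProduct.ext ?_ (lorentzMatrix_injective ?_)
  · obtain ⟨h0, h1⟩ := translation_eq_zero hg
    change g.left.toAdd + lorentzMatrix g.right *ᵥ (0 : Spacetime) =
      (0 : Spacetime) + boostMatrix t *ᵥ g.left.toAdd
    ext i
    fin_cases i <;> simp [boostMatrix, dotProduct, Fin.sum_univ_four, h0, h1]
  · obtain ⟨c, s, p, q, u, v, hM⟩ := lorentzMatrix_eq_block hg
    change lorentzMatrix g.right * boostMatrix t = boostMatrix t * lorentzMatrix g.right
    rw [hM]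
    ext i j
    fin_cases i <;> fin_cases j <;> simp [boostMatrix, mul_apply, Fin.sum_univ_four] <;> ring

end Stabilizer

namespace Wedge

theorem compl_smul (g : Poincare) (W : Wedge) : (g • W).compl = g • W.compl :=
  Subtype.ext (causalComplement_smul g W.1)

theorem boosts_add (W : Wedge) (s t : ℝ) : W.boosts (s + t) = W.boosts s * W.boosts t := by
  simp only [boosts, boost_add, lorentz_mul]
  group

theorem exists_boosts_eq (W : Wedge) :
    ∃ g : Poincare, W.1 = g • rightWedge ∧ ∀ t, W.boosts t = g * lorentz (boost t) * g⁻¹ :=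
  ⟨W.2.choose, W.2.choose_spec, fun _ => rfl⟩

theorem boosts_smul (W : Wedge) (t : ℝ) : W.boosts t • W = W := by
  obtain ⟨g, hW, hb⟩ := W.exists_boosts_eq
  refine Subtype.ext ?_
  change W.boosts t • W.1 = W.1
  rw [hb, hW, smul_smul, inv_mul_cancel_right, mul_smul, boost_smul_rightWedge]

theorem exists_smul_eq_and_boosts_mul (W V : Wedge) :
    ∃ g : Poincare, g • W = V ∧ ∀ t, V.boosts t * g = g * W.boosts t := by
  obtain ⟨g, hW, hbW⟩ := W.exists_boosts_eq
  obtain ⟨h, hV, hbV⟩ := V.exists_boosts_eq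
  refine ⟨h * g⁻¹, Subtype.ext ?_, fun t => ?_⟩
  · change (h * g⁻¹) • W.1 = V.1
    rw [hW, hV, smul_smul, inv_mul_cancel_right]
  · rw [hbW, hbV]
    group

theorem mul_boosts_of_smul_eq_compl {W : Wedge} {r : Poincare} (hr : r • W = W.compl) (t : ℝ) :
    r * W.boosts t = (W.boosts t)⁻¹ * r := by
  obtain ⟨g, hW, hboosts⟩ := W.exists_boosts_eq
  set ρ := lorentz (spaceRotation Real.pi)
  set b := lorentz (boost t) with hb
  have hrW : r • g • rightWedge = g • ρ • rightWedge := by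
    rw [← hW, spaceRotation_smul_rightWedge, ← causalComplement_rightWedge,
      ← causalComplement_smul, ← hW]
    exact congrArg Subtype.val hr
  have hcomm : Commute (ρ⁻¹ * g⁻¹ * r * g) b := by
    refine commute_boost_of_smul_rightWedge ?_ t
    rw [mul_smul, mul_smul, hrW, mul_smul, inv_smul_smul, inv_smul_smul]
  have hρ : ρ * b = b⁻¹ * ρ := by
    rw [← lorentz_mul, spaceRotation_pi_mul_boost, lorentz_mul, lorentz_inv]
  calc r * W.boosts t
    _ = g * ρ * ((ρ⁻¹ * g⁻¹ * r * g) * b) * g⁻¹ := by rw [hboosts, ← hb]; group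
    _ = g * (ρ * b) * (ρ⁻¹ * g⁻¹ * r) := by rw [hcomm.eq]; group
    _ = (W.boosts t)⁻¹ * r := by rw [hρ, hboosts, ← hb]; group

end Wedge

end Minkowski

open TomitaTakesaki in
theorem theorem3p1_general {H : Type*} [NormedAddCommGroup H] [InnerProductSpace ℂ H]
    [CompleteSpace H] (U : Poincare →* unitary (H →L[ℂ] H)) (K : Wedge → StandardSubspace H)
    (hcov : ∀ g V, K (g • V) = U g • K V) (W : Wedge) (r : Poincare)
    (hloc : (K W.compl).toClosedSubmodule ≤ (K W).symplComp.toClosedSubmodule)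
    (hr : r • W = W.compl)
    (hZ : ∀ t : ℝ, Commute ((K W).modularGroup t * (U (W.boosts (2 * Real.pi * t)) : H →L[ℂ] H))
      (U r)) :
    (∀ V t, (U (V.boosts (2 * Real.pi * t)) : H →L[ℂ] H) = (K V).modularGroup (-t)) ∧
      ∀ V, K V = (K V.compl).symplComp := by
  have hrU (t : ℝ) : U r * U (W.boosts (2 * Real.pi * t)) =
      (U (W.boosts (2 * Real.pi * t)))⁻¹ * U r := by
    rw [← map_mul, Wedge.mul_boosts_of_smul_eq_compl hr, map_mul, map_inv]
  have hdual : U r • K W = (K W).symplComp :=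
    smul_eq_symplComp (by rwa [← hcov, hr]) (fun t => by rw [← hcov, Wedge.boosts_smul]) hrU hZ
  have hBW (t : ℝ) : (U (W.boosts (2 * Real.pi * t)) : H →L[ℂ] H) = (K W).modularGroup (-t) := by
    rw [show 2 * Real.pi * t = 2 * Real.pi * (t / 2) + 2 * Real.pi * (t / 2) by ring,
      Wedge.boosts_add, map_mul, coe_mul_self_eq_modularGroup hdual (hrU _) (hZ _)]
    ring_nf
  refine ⟨fun V t => ?_, fun V => ?_⟩ <;>
    obtain ⟨g, rfl, hg⟩ := W.exists_smul_eq_and_boosts_mul V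
  · refine (Unitary.toUnits (U g)).isUnit.mul_right_cancel ?_
    change _ * (U g : H →L[ℂ] H) = _ * (U g : H →L[ℂ] H)
    rw [hcov, modularGroup_smul_mul, ← hBW, ← Submonoid.coe_mul, ← Submonoid.coe_mul, ← map_mul,
      hg, map_mul]
  · rw [Wedge.compl_smul, hcov, hcov, symplComp_smul, ← hr, hcov, hdual,
      StandardSubspace.symplComp_symplComp_eq]

theorem theorem3p1 {H : Type*} [NormedAddCommGroup H] [InnerProductSpace ℂ H] [CompleteSpace H]
    (U : PositiveEnergyRep H) (N : CovariantNet U) (W : Wedge) (r : Poincare)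
    (hr : r • W = W.compl) (hZ : ∀ t : ℝ, Commute (N.Z W t) (U.op r)) :
    N.BisognanoWichmann ∧ N.WedgeDuality := by
  have hcov (g : Poincare) (V : Wedge) : N.standard (g • V) = U.toHom g • N.standard V :=
    StandardSubspace.toClosedSubmodule_inj.1 (SetLike.coe_injective (N.covariance V g).symm)
  obtain ⟨hBW, hdual⟩ :=
    theorem3p1_general U.toHom N.standard hcov W r (N.locality _ _ subset_rfl) hr hZ
  exact ⟨hBW, fun V => congrArg StandardSubspace.toClosedSubmodule (hdual V)⟩
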